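/- **Setting.** Let $R$ be a finite set with $n$ elements, totally ordered by value. Let $\mathcal L$ be a laminar family of non-empty subsets of $R$ (any $L,H\in\mathcal L$ satisfy $L\cap H\in\{L,H,\emptyset\}$) with positive integer capacities $c(L)$, and let $\mathcal M$ be the laminar matroid on $R$, in which $I\subseteq R$ is independent iff $|I\cap L|\le c(L)$ for all $L\in\mathcal L$. For $Q\subseteq R$, $\mathrm{OPT}(Q)$ denotes the independent set that the greedy algorithm builds when it goes through $Q$ from the best element to the worst; $\mathrm{OPT}=\mathrm{OPT}(R)$. Let $T$ be the rooted tree whose nodes are $R$, the members of $\mathcal L$ and all singletons, ordered by inclusion (the parent of a node is the smallest node strictly containing it), with an additional vertex $s_0$ placed above $R$. Its leaves $\{x\}$ are identified with the elements $x\in R$. Write $x\vee y$ for the lowest common ancestor and $u\sqsubset v$ if $v$ is a proper ancestor of $u$. Fix a plane drawing of $T$ with all arcs pointing downwards and the leaves at the bottom, i.e. a left-to-right order of the children of every node (such drawings always exist); it induces a left-to-right order of $R$. For $J\subseteq R$ and $y\in R\setminus J$ let $\mathrm{pre}$ and $\mathrm{nex}$ be the elements of $J$ closest to $y$ on its left and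 on its right; if there is none, an auxiliary leaf attached directly to $s_0$ is used, so that its lowest common ancestor with $y$ is $s_0$. For non-empty $J$ the representative $\pi_J(y)\in J$ is $y$ if $y\in J$; for $y\notin J$ it is $\mathrm{pre}$ if $y\vee \mathrm{pre}\sqsubset y\vee\mathrm{nex}$, and $\mathrm{nex}$ otherwise. **Algorithm** (with sampling probability $p\in[0,1]$). The elements $r_1,\dots,r_n$ arrive in uniformly random order; $R_t=\{r_1,\dots,r_t\}$. Draw $s\sim\mathrm{Bin}(n,p)$ independently. If $s=0$, return $\{r_1\}$ ($\emptyset$ if $n=0$). Otherwise start with $\mathrm{ALG}=B=\emptyset$; for $i=s+1,\dots,n$, if $r_i\in\mathrm{OPT}(R_i)$ and $\pi_{\mathrm{OPT}(R_s)}(r_i)\notin B$, add $r_i$ to $\mathrm{ALG}$ and $\pi_{\mathrm{OPT}(R_s)}(r_i)$ to $B$. Return $\mathrm{ALG}$. An algorithm *has forbidden sets of size $k$* if (i) it always returns an independent set; (ii) it draws $s$ from $\mathrm{Bin}(n,p)$ for some fixed $p$ and accepts none of the first $s$ elements; (iii) for all $Y\subseteq R$, $r^*\in\mathrm{OPT}(Y)$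 and $X\subseteq Y\setminus\{r^*\}$ one can define $\mathcal F(X,Y,r^*)\subseteq X$ with at most $k$ elements such that, for every sample size $s$, every arrival order and every $t\ge s+1$: if $r_t\in\mathrm{OPT}(R_t)$ and $r_j\notin\mathcal F(R_j,R_t,r_t)$ for all $j\in\{s+1,\dots,t-1\}$, then $r_t$ is selected. It is *$\alpha$ probability-competitive* ($\alpha\ge1$) if $\Pr(e\in\mathrm{ALG})\ge 1/\alpha$ for every $e\in\mathrm{OPT}$. **Theorem.** For every laminar matroid and every such drawing, the algorithm has forbidden sets of size $3$ (for every $p\in[0,1]$), and with $p=\sqrt{1/3}$ it is $3\sqrt3$ probability-competitive. -/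

import Mathlib

namespace SecretaryMSP

open Finset

/-! ### Laminar matroids -/

/-- A laminar family `sets` of non-empty subsets of the finite set `α`, with a positive integer
capacity on each of its members. -/
structure LaminarSystem (α : Type*) [DecidableEq α] where
  sets : Finset (Finset α)
  nonempty : ∀ L ∈ sets, L.Nonempty
  laminar : ∀ L ∈ sets, ∀ H ∈ sets, L ∩ H = L ∨ L ∩ H = H ∨ L ∩ H = ∅
  cap : Finset α → ℕ
  cap_pos : ∀ L ∈ sets, 0 < cap L

namespace LaminarSystem

/-- `I` is independent if it contains at most `cap L` elements of each member `L`. -/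
def Indep {α : Type*} [DecidableEq α] (S : LaminarSystem α) (I : Set α) : Prop :=
  ∀ L ∈ S.sets, (I ∩ (L : Set α)).ncard ≤ S.cap L

theorem Indep.augment {α : Type*} [Fintype α] [DecidableEq α] (S : LaminarSystem α)
    {I J : Set α} (hI : S.Indep I) (hJ : S.Indep J) (hIJ : I.ncard < J.ncard) :
    ∃ e ∈ J, e ∉ I ∧ S.Indep (insert e I) := by
  classical
  by_contra hcon
  push Not at hcon
  -- the saturated members of the family
  let T : Finset (Finset α) := S.sets.filter (fun L => S.cap L ≤ (I ∩ (L : Set α)).ncard)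
  -- the inclusion-maximal saturated members
  let W : Finset (Finset α) := T.filter (fun L => ∀ H ∈ T, L ⊆ H → H ⊆ L)
  have hcov : ∀ e ∈ J, e ∉ I → ∃ L ∈ W, e ∈ L := by
    intro e heJ heI
    have h := hcon e heJ heI
    simp only [Indep] at h
    push Not at h
    obtain ⟨L, hL, hlt⟩ := h
    have heL : e ∈ L := by
      by_contra hne
      have : insert e I ∩ (L : Set α) = I ∩ (L : Set α) :=
        Set.insert_inter_of_notMem (by simpa using hne)
      rw [this] at hlt
      exact absurd (hI L hL) (not_le.2 hlt)
    have hLT : L ∈ T := by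
      refine mem_filter.2 ⟨hL, ?_⟩
      rw [Set.insert_inter_of_mem (by simpa using heL)] at hlt
      have := Set.ncard_insert_le e (I ∩ (L : Set α))
      omega
    obtain ⟨M, hLM, hM⟩ := T.exists_le_maximal hLT
    exact ⟨M, mem_filter.2 ⟨hM.1, fun H hH hMH => hM.2 hH hMH⟩, hLM heL⟩
  have hdisj : ∀ L ∈ W, ∀ H ∈ W, L ≠ H → Disjoint L H := by
    intro L hL H hH hne
    obtain ⟨hLT, hLm⟩ := mem_filter.1 hL
    obtain ⟨hHT, hHm⟩ := mem_filter.1 hH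
    rcases S.laminar L (mem_filter.1 hLT).1 H (mem_filter.1 hHT).1 with h | h | h
    · have hs : L ⊆ H := inter_eq_left.1 h
      exact absurd (hs.antisymm (hLm H hHT hs)) hne
    · have hs : H ⊆ L := inter_eq_right.1 h
      exact absurd ((hHm L hLT hs).antisymm hs) hne
    · exact disjoint_iff_inter_eq_empty.2 h
  let U : Finset α := W.biUnion id
  let I' : Finset α := I.toFinite.toFinset
  let J' : Finset α := J.toFinite.toFinset
  have hcard : ∀ (K : Set α) (L : Finset α),
      (K.toFinite.toFinset ∩ L).card = (K ∩ (L : Set α)).ncard := by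
    intro K L
    rw [← Set.ncard_coe_finset]
    simp
  have hsplit : ∀ K : Finset α, K.card = ∑ L ∈ W, (K ∩ L).card + (K \ U).card := by
    intro K
    rw [← card_inter_add_card_sdiff K U]
    congr 1
    have : K ∩ U = W.biUnion (fun L => K ∩ L) := by
      ext x
      simp only [U, mem_inter, mem_biUnion, id_eq]
      exact ⟨fun ⟨h, L, hL, hx⟩ => ⟨L, hL, h, hx⟩, fun ⟨L, hL, h, hx⟩ => ⟨h, L, hL, hx⟩⟩
    rw [this, card_biUnion]
    intro L hL H hH hne
    exact (hdisj L hL H hH hne).mono inter_subset_right inter_subset_right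
  have h1 : ∑ L ∈ W, (J' ∩ L).card ≤ ∑ L ∈ W, (I' ∩ L).card := by
    refine sum_le_sum fun L hL => ?_
    have hLT := mem_filter.1 (mem_filter.1 hL).1
    rw [hcard, hcard]
    exact (hJ L hLT.1).trans hLT.2
  have h2 : (J' \ U).card ≤ (I' \ U).card := by
    refine card_le_card fun x hx => ?_
    obtain ⟨hxJ, hxU⟩ := mem_sdiff.1 hx
    refine mem_sdiff.2 ⟨?_, hxU⟩
    by_contra hxI
    obtain ⟨L, hL, hxL⟩ := hcov x (by simpa [J'] using hxJ) (by simpa [I'] using hxI)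
    exact hxU (mem_biUnion.2 ⟨L, hL, hxL⟩)
  have h3 := hsplit I'
  have h4 := hsplit J'
  have h5 : I.ncard = I'.card := Set.ncard_eq_toFinset_card I
  have h6 : J.ncard = J'.card := Set.ncard_eq_toFinset_card J
  omega

/-- The laminar matroid of a laminar family with capacities; its ground set is all of `α`. -/
def matroid {α : Type*} [Fintype α] [DecidableEq α] (S : LaminarSystem α) : Matroid α :=
  (IndepMatroid.ofFinite (E := Set.univ) Set.finite_univ S.Indep
    (fun L _ => by simp)
    (fun _ _ hJ hIJ L hL =>
      (Set.ncard_le_ncard (Set.inter_subset_inter_left _ hIJ) (Set.toFinite _)).trans (hJ L hL))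
    (fun _ _ hI hJ h => Indep.augment S hI hJ h)
    (fun _ _ => Set.subset_univ _)).matroid

/-! ### The tree of a laminar family and its drawings -/

/-- The nodes of the tree other than the source: the members of the family, the whole ground set
(the root) and all singletons (the leaves; the leaf `{x}` is the terminal `x`). -/
def nodes {α : Type*} [Fintype α] [DecidableEq α] (S : LaminarSystem α) : Finset (Finset α) :=
  S.sets ∪ {univ} ∪ univ.image (fun x => {x})

/-- `C` is a child of `N`: `N` is the smallest node that strictly contains `C`. -/
def IsChild {α : Type*} [Fintype α] [DecidableEq α] (S : LaminarSystem α)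
    (C N : Finset α) : Prop :=
  C ∈ S.nodes ∧ N ∈ S.nodes ∧ C ⊂ N ∧ ∀ H ∈ S.nodes, C ⊂ H → N ⊆ H

/-- A plane drawing of the rooted tree, with the root on top, all arcs pointing downwards and the
terminals on a horizontal line at the bottom. Such a drawing is recorded through the left-to-right
order of the children of each node, given by horizontal positions. -/
structure Drawing {α : Type*} [Fintype α] [DecidableEq α] (S : LaminarSystem α) where
  pos : Finset α → ℝ
  pos_inj : ∀ N C C' : Finset α, S.IsChild C N → S.IsChild C' N → pos C = pos C' → C = C'

/-- The lowest common ancestor of two terminals: the smallest node containing both, that is, the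
intersection of all the nodes containing both. -/
def lca {α : Type*} [Fintype α] [DecidableEq α] (S : LaminarSystem α) (x y : α) : Finset α :=
  (S.nodes.filter (fun N => x ∈ N ∧ y ∈ N)).inf id

/-- The lowest common ancestor of the terminal `y` and `z`, where `z` is a terminal or (`none`) one
of the two auxiliary leaves hanging from the source. Vertices of the tree are ordered by "is a
descendant of", which is inclusion for nodes; the source is the top element `⊤`. -/
def join {α : Type*} [Fintype α] [DecidableEq α] (S : LaminarSystem α) (y : α) :
    Option α → WithTop (Finset α)
  | none => ⊤
  | some z => (S.lca y z : Finset α)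

namespace Drawing

/-- The terminal `x` is drawn to the left of the terminal `y`: where their paths from the root
separate, the branch of `x` leaves to the left of the branch of `y`. -/
def LeftOf {α : Type*} [Fintype α] [DecidableEq α] {S : LaminarSystem α} (D : S.Drawing)
    (x y : α) : Prop :=
  ∃ N C C' : Finset α, S.IsChild C N ∧ S.IsChild C' N ∧ x ∈ C ∧ y ∈ C' ∧ D.pos C < D.pos C'

open Classical in
/-- The label in `1, …, n` of a terminal, counted from left to right. -/
noncomputable def label {α : Type*} [Fintype α] [DecidableEq α] {S : LaminarSystem α}
    (D : S.Drawing) (x : α) : ℕ :=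
  (univ.filter (fun z => D.LeftOf z x)).card + 1

/-- The left neighbour of `y` in `J`: the closest element of `J` strictly to the left of `y`, or
`none` (the auxiliary leaf on the left) if there is no such element. -/
noncomputable def pre {α : Type*} [Fintype α] [DecidableEq α] {S : LaminarSystem α}
    (D : S.Drawing) (J : Finset α) (y : α) : Option α :=
  (J.filter (fun j => D.label j < D.label y)).toList.argmax D.label

/-- The right neighbour of `y` in `J`: the closest element of `J` strictly to the right of `y`, or
`none` (the auxiliary leaf on the right) if there is no such element. -/
noncomputable def nex {α : Type*} [Fintype α] [DecidableEq α] {S : LaminarSystem α}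
    (D : S.Drawing) (J : Finset α) (y : α) : Option α :=
  (J.filter (fun j => D.label y < D.label j)).toList.argmin D.label

open Classical in
/-- The representative of `y` in `J`: `y` itself if `y ∈ J`, and otherwise the neighbour of `y` in
`J` whose lowest common ancestor with `y` is the lower one, the right neighbour in case of a tie.
For non-empty `J` it is always an element of `J`. -/
noncomputable def rep {α : Type*} [Fintype α] [DecidableEq α] {S : LaminarSystem α}
    (D : S.Drawing) (J : Finset α) (y : α) : Option α :=
  if y ∈ J then some y
  else if S.join y (D.pre J y) < S.join y (D.nex J y) then D.pre J y
  else D.nex J y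

end Drawing

end LaminarSystem

/-! ### The ordinal matroid secretary problem

The linear order of `α` is the value order: larger elements are better. -/

open Classical in
/-- The optimum `OPT(Q)`: the output of the greedy algorithm, which goes through `Q` from the best
element to the worst one and keeps an element whenever this preserves independence. -/
noncomputable def greedyOpt {α : Type*} [LinearOrder α] (M : Matroid α) (Q : Finset α) :
    Finset α :=
  (Q.sort (fun a b => b ≤ a)).foldl
    (fun I e => if M.Indep (insert e (I : Set α)) then insert e I else I) ∅

/-- An arrival order: `σ i` is the element that arrives at time `i + 1`. -/
abbrev Arrival (α : Type*) [Fintype α] : Type _ := Fin (Fintype.card α) ≃ α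

/-- The set `R_t` of the first `t` elements to arrive. -/
def arrived {α : Type*} [Fintype α] (σ : Arrival α) (t : ℕ) : Finset α :=
  univ.filter (fun x => (σ.symm x : ℕ) < t)

/-- An algorithm whose only random choice is a sample size `s`, drawn from `sampleLaw`
independently of the arrival order; `output s σ` is the set it returns. -/
structure SamplingAlgorithm (α : Type*) [Fintype α] where
  sampleLaw : MeasureTheory.Measure ℕ
  isProb : MeasureTheory.IsProbabilityMeasure sampleLaw
  output : ℕ → Arrival α → Finset α

/-- The algorithm has forbidden sets of size `k`: it always returns an independent set, it draws
its sample size from a binomial law `Bin(n, p)` and accepts no element of the sample, and it has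
the `k`-forbidden property. -/
def HasForbiddenSets {α : Type*} [Fintype α] [LinearOrder α] (M : Matroid α)
    (A : SamplingAlgorithm α) (k : ℕ) : Prop :=
  (∀ s ≤ Fintype.card α, ∀ σ : Arrival α, M.Indep (A.output s σ : Set α)) ∧
  (∃ p : unitInterval, A.sampleLaw = ProbabilityTheory.binomial (Fintype.card α) p) ∧
  (∀ s ≤ Fintype.card α, ∀ σ : Arrival α, ∀ x ∈ arrived σ s, x ∉ A.output s σ) ∧
  ∃ F : Finset α → Finset α → α → Finset α,
    (∀ (X Y : Finset α) (r : α), r ∈ greedyOpt M Y → X ⊆ Y.erase r →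
      F X Y r ⊆ X ∧ (F X Y r).card ≤ k) ∧
    ∀ s ≤ Fintype.card α, ∀ (σ : Arrival α) (t : Fin (Fintype.card α)), s ≤ (t : ℕ) →
      σ t ∈ greedyOpt M (arrived σ (t + 1)) →
      (∀ j : Fin (Fintype.card α), s ≤ (j : ℕ) → j < t →
        σ j ∉ F (arrived σ (j + 1)) (arrived σ (t + 1)) (σ t)) →
      σ t ∈ A.output s σ

/-- The probability that `e` is in the output, the arrival order being uniformly random and
independent of the sample size. -/
noncomputable def selectionProb {α : Type*} [Fintype α] [DecidableEq α]
    (A : SamplingAlgorithm α) (e : α) : ℝ :=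
  (∑ σ : Arrival α, A.sampleLaw.real {s | e ∈ A.output s σ}) / Fintype.card (Arrival α)

/-- `a` probability-competitiveness: each element of the optimum is selected with probability at
least `1 / a`. -/
def IsProbCompetitive {α : Type*} [Fintype α] [LinearOrder α] (M : Matroid α)
    (A : SamplingAlgorithm α) (a : ℝ) : Prop :=
  1 ≤ a ∧ ∀ e ∈ greedyOpt M univ, 1 / a ≤ selectionProb A e

/-! ### The algorithm for laminar matroids -/

open Classical in
/-- One step of the main loop, at the time at which `σ i` arrives, with state `(ALG, B)`: `J` is
the optimum of the sample and `B` the set of marked representatives. -/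
noncomputable def laminarStep {α : Type*} [Fintype α] [LinearOrder α] {S : LaminarSystem α}
    (D : S.Drawing) (J : Finset α) (σ : Arrival α) (st : Finset α × Finset (Option α))
    (i : Fin (Fintype.card α)) : Finset α × Finset (Option α) :=
  if σ i ∈ greedyOpt S.matroid (arrived σ (i + 1)) ∧ D.rep J (σ i) ∉ st.2 then
    (insert (σ i) st.1, insert (D.rep J (σ i)) st.2)
  else st

/-- The output for sample size `s` and arrival order `σ`: the first element if `s = 0`; otherwise
the main loop is run over all the elements that arrive after the sample. -/
noncomputable def laminarOutput {α : Type*} [Fintype α] [LinearOrder α] {S : LaminarSystem α}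
    (D : S.Drawing) (s : ℕ) (σ : Arrival α) : Finset α :=
  if s = 0 then arrived σ 1
  else (((List.finRange (Fintype.card α)).drop s).foldl
    (laminarStep D (greedyOpt S.matroid (arrived σ s)) σ) (∅, ∅)).1

/-- The algorithm for laminar matroids with sampling probability `p`. -/
noncomputable def laminarAlgorithm {α : Type*} [Fintype α] [LinearOrder α] {S : LaminarSystem α}
    (D : S.Drawing) (p : unitInterval) : SamplingAlgorithm α where
  sampleLaw := ProbabilityTheory.binomial (Fintype.card α) p
  isProb := inferInstance
  output := laminarOutput D

end SecretaryMSP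

/-! Independence: every node is an interval in the left-to-right order. If a member L of the family
meets the sample optimum J, the representatives of elements of L lie in J ∩ L (`rep_mem_node`), so
distinct representatives give at most |J ∩ L| accepted elements in L. If L misses J, all its
elements share one representative (`rep_eq_of_mem_node`), so at most one is accepted, which a
positive capacity allows.

Forbidden sets: F(X, Y, r) consists of the two neighbours of r in K = OPT(X) and of one second
neighbour, beyond the neighbour closer to r in the tree. Suppose an earlier optimal arrival blocks
r, and take the first arrival x after the sample that is optimal on arrival and either lies in the
gap of J around r or has the representative of r. Membership in the optimum is inherited by subsets
(`mem_greedyOpt_of_subset`), so every other element of K is in J or is an earlier arrival that is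
neither in the gap nor represented like r. Hence x is next to r in K, or next to it except for the
common representative in between, and x is forbidden (`mem_forbidden_of_first`).

Competitiveness: fix e in OPT and let u(s, t) count the orders with e at time t and no forbidden
arrival at times in [s, t). The order of the first s + 1 arrivals is exchangeable given all the
rest, so (s + 1) u(s, t) ≥ (s - 2) u(s + 1, t) (`card_goodOrders_succ`). Summing over t gives a
lower bound linear in s and s.choose 3 (`le_sum_of_recurrence`), and the binomial moments turn it
into the selection probability (p - p³)/2, whatever n is. This uses only the forbidden sets and
heredity, not laminarity. -/

namespace SecretaryMSP

open Finset

namespace LaminarSystem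

/-! ### The tree: nodes, lowest common ancestors, children. -/

section Tree

variable {α : Type*} [Fintype α] [DecidableEq α] {S : LaminarSystem α}

theorem nonempty_drawing (S : LaminarSystem α) : Nonempty S.Drawing :=
  ⟨⟨fun C => ((Fintype.equivFin (Finset α) C : ℕ) : ℝ), fun N C C' _ _ h => by
    simpa [Fin.val_inj] using h⟩⟩

theorem univ_mem_nodes (S : LaminarSystem α) : univ ∈ S.nodes := by simp [nodes]

theorem singleton_mem_nodes (S : LaminarSystem α) (x : α) : {x} ∈ S.nodes := by simp [nodes]

theorem mem_nodes_of_mem_sets {L : Finset α} (h : L ∈ S.sets) : L ∈ S.nodes := by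
  simp [nodes, h]

theorem nodes_comparable {L H : Finset α} (hL : L ∈ S.nodes) (hH : H ∈ S.nodes) {x : α}
    (hxL : x ∈ L) (hxH : x ∈ H) : L ⊆ H ∨ H ⊆ L := by
  simp only [nodes, mem_union, mem_singleton, mem_image, mem_univ, true_and] at hL hH
  rcases hL with (hL | rfl) | ⟨y, rfl⟩
  · rcases hH with (hH | rfl) | ⟨z, rfl⟩
    · rcases S.laminar L hL H hH with h | h | h
      · exact Or.inl (inter_eq_left.1 h)
      · exact Or.inr (inter_eq_right.1 h)
      · have : x ∈ L ∩ H := mem_inter.2 ⟨hxL, hxH⟩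
        rw [h] at this
        simp at this
    · exact Or.inl (subset_univ _)
    · rw [mem_singleton] at hxH
      exact Or.inr (by simpa [← hxH] using hxL)
  · exact Or.inr (subset_univ _)
  · rw [mem_singleton] at hxL
    exact Or.inl (by simpa [← hxL] using hxH)

theorem left_mem_lca (x y : α) : x ∈ S.lca x y := by
  have : ({x} : Finset α) ≤ S.lca x y := Finset.le_inf fun N hN => by simpa using (mem_filter.1 hN).2.1
  simpa using this

theorem right_mem_lca (x y : α) : y ∈ S.lca x y := by
  have : ({y} : Finset α) ≤ S.lca x y := Finset.le_inf fun N hN => by simpa using (mem_filter.1 hN).2.2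
  simpa using this

theorem lca_subset {N : Finset α} (hN : N ∈ S.nodes) {x y : α} (hx : x ∈ N) (hy : y ∈ N) :
    S.lca x y ⊆ N :=
  Finset.inf_le (f := id) (mem_filter.2 ⟨hN, hx, hy⟩)

/-- The nodes through a given terminal form a chain, so a minimal node containing both terminals is
the least one and equals the intersection. -/
theorem lca_mem_nodes (x y : α) : S.lca x y ∈ S.nodes := by
  obtain ⟨N, hN, hmin⟩ := (S.nodes.filter (fun N => x ∈ N ∧ y ∈ N)).exists_minimal
    ⟨univ, mem_filter.2 ⟨S.univ_mem_nodes, mem_univ _, mem_univ _⟩⟩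
  have hN' := mem_filter.1 hN
  have : S.lca x y = N := by
    refine (lca_subset hN'.1 hN'.2.1 hN'.2.2).antisymm (Finset.le_inf fun H hH => ?_)
    have hH' := mem_filter.1 hH
    rcases nodes_comparable hN'.1 hH'.1 hN'.2.1 hH'.2.1 with h | h
    · exact h
    · exact hmin hH h
  exact this ▸ hN'.1

theorem IsChild.eq_of_mem {C C' N : Finset α} (h : S.IsChild C N) (h' : S.IsChild C' N) {x : α}
    (hx : x ∈ C) (hx' : x ∈ C') : C = C' := by
  by_contra hne
  rcases nodes_comparable h.1 h'.1 hx hx' with hs | hs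
  · exact h'.2.2.1.not_subset (h.2.2.2 C' h'.1 (hs.ssubset_of_ne hne))
  · exact h.2.2.1.not_subset (h'.2.2.2 C h.1 (hs.ssubset_of_ne (Ne.symm hne)))

/-- A node sharing an element with a child of `N` lies inside that child or contains `N`. -/
theorem IsChild.subset_or_subset {C N L : Finset α} (h : S.IsChild C N) (hL : L ∈ S.nodes) {x : α}
    (hx : x ∈ C) (hxL : x ∈ L) : L ⊆ C ∨ N ⊆ L := by
  rcases nodes_comparable hL h.1 hxL hx with hs | hs
  · exact Or.inl hs
  · rcases eq_or_ne C L with rfl | hne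
    · exact Or.inl subset_rfl
    · exact Or.inr (h.2.2.2 L hL (hs.ssubset_of_ne hne))

theorem exists_isChild_mem {N : Finset α} (hN : N ∈ S.nodes) {x y : α} (hx : x ∈ N) (hy : y ∈ N)
    (hxy : x ≠ y) : ∃ C, S.IsChild C N ∧ x ∈ C := by
  obtain ⟨C, hC, hmax⟩ := (S.nodes.filter (fun C => x ∈ C ∧ C ⊂ N)).exists_maximal
    ⟨{x}, mem_filter.2 ⟨S.singleton_mem_nodes x, mem_singleton_self x, by
      refine ssubset_of_subset_of_ne (by simpa using hx) ?_
      rintro rfl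
      exact hxy (mem_singleton.1 hy).symm⟩⟩
  obtain ⟨hCn, hxC, hCN⟩ := mem_filter.1 hC
  refine ⟨C, ⟨hCn, hN, hCN, fun H hH hCH => ?_⟩, hxC⟩
  rcases nodes_comparable hN hH hx (hCH.1 hxC) with h | h
  · exact h
  · rcases eq_or_ne H N with rfl | hne
    · exact subset_rfl
    · exact absurd (hmax (mem_filter.2 ⟨hH, hCH.1 hxC, h.ssubset_of_ne hne⟩) hCH.1) hCH.2

/-! ### The left-to-right order, neighbours and representatives. -/

namespace Drawing

variable {D : S.Drawing}

theorem LeftOf.irrefl {x : α} : ¬ D.LeftOf x x := by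
  rintro ⟨N, C, C', hC, hC', hx, hx', hlt⟩
  rw [hC.eq_of_mem hC' hx hx'] at hlt
  exact lt_irrefl _ hlt

theorem leftOf_or_leftOf {x y : α} (hxy : x ≠ y) : D.LeftOf x y ∨ D.LeftOf y x := by
  obtain ⟨C, hC, hxC⟩ := exists_isChild_mem (lca_mem_nodes (S := S) x y) (left_mem_lca x y)
    (right_mem_lca x y) hxy
  obtain ⟨C', hC', hyC'⟩ := exists_isChild_mem (lca_mem_nodes (S := S) x y) (right_mem_lca x y)
    (left_mem_lca x y) hxy.symm
  rcases lt_trichotomy (D.pos C) (D.pos C') with h | h | h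
  · exact Or.inl ⟨_, C, C', hC, hC', hxC, hyC', h⟩
  -- A single child containing both terminals would be a smaller common ancestor.
  · obtain rfl := D.pos_inj _ _ _ hC hC' h
    exact absurd (lca_subset hC.1 hxC hyC') hC.2.2.1.not_subset
  · exact Or.inr ⟨_, C', C, hC', hC, hyC', hxC, h⟩

/-- Both branching nodes contain y, hence are comparable: the higher one separates x from z, and if
they coincide the positions of the three branches compose. -/
theorem LeftOf.trans {x y z : α} (h₁ : D.LeftOf x y) (h₂ : D.LeftOf y z) : D.LeftOf x z := by
  obtain ⟨N, C, C', hC, hC', hx, hy, hlt⟩ := h₁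
  obtain ⟨M, B, B', hB, hB', hy', hz, hlt'⟩ := h₂
  rcases hB.subset_or_subset hC.2.1 hy' (hC'.2.2.1.1 hy) with h | h
  · exact ⟨M, B, B', hB, hB', h (hC.2.2.1.1 hx), hz, hlt'⟩
  · rcases hC'.subset_or_subset hB.2.1 hy (hB.2.2.1.1 hy') with h' | h'
    · exact ⟨N, C, C', hC, hC', hx, h' (hB'.2.2.1.1 hz), hlt⟩
    · obtain rfl := h.antisymm h'
      rw [hC'.eq_of_mem hB hy hy'] at hlt
      exact ⟨M, C, B', hC, hB', hx, hz, hlt.trans hlt'⟩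

theorem label_lt_label_iff {x y : α} : D.label x < D.label y ↔ D.LeftOf x y := by
  classical
  have key : ∀ {x y : α}, D.LeftOf x y → D.label x < D.label y := by
    intro x y h
    refine Nat.add_lt_add_right (card_lt_card ⟨fun z hz => ?_, fun hs => ?_⟩) 1
    · simp only [mem_filter, mem_univ, true_and] at hz ⊢
      exact hz.trans h
    · have := hs (mem_filter.2 ⟨mem_univ x, h⟩)
      exact LeftOf.irrefl (mem_filter.1 this).2
  refine ⟨fun h => ?_, key⟩
  have hne : x ≠ y := by
    rintro rfl
    exact lt_irrefl _ h
  exact (leftOf_or_leftOf hne).resolve_right fun h' => lt_asymm h (key h')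

theorem label_injective (D : S.Drawing) : Function.Injective D.label := by
  intro x y h
  by_contra hne
  rcases leftOf_or_leftOf (D := D) hne with h' | h' <;>
    exact absurd (label_lt_label_iff.2 h') (by omega)

theorem label_lt_or_lt (D : S.Drawing) {x y : α} (h : x ≠ y) :
    D.label x < D.label y ∨ D.label y < D.label x :=
  lt_or_gt_of_ne fun h' => h (D.label_injective h')

theorem LeftOf.of_mem_node {L : Finset α} (hL : L ∈ S.nodes) {x y z : α} (hx : x ∈ L) (hz : z ∈ L)
    (hy : y ∉ L) (h : D.LeftOf x y) : D.LeftOf z y := by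
  obtain ⟨N, C, C', hC, hC', hxC, hyC', hlt⟩ := h
  rcases hC.subset_or_subset hL hxC hx with h | h
  · exact ⟨N, C, C', hC, hC', h hz, hyC', hlt⟩
  · exact absurd (h (hC'.2.2.1.1 hyC')) hy

/-- An element outside a node is on the same side of all elements of the node. -/
theorem label_lt_iff_of_mem_node {L : Finset α} (hL : L ∈ S.nodes) {x y z : α} (hx : x ∈ L)
    (hz : z ∈ L) (hy : y ∉ L) : D.label y < D.label x ↔ D.label y < D.label z := by
  have aux : ∀ {x z : α}, x ∈ L → z ∈ L → D.label x < D.label y → D.label z < D.label y :=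
    fun hx hz h => label_lt_label_iff.2 ((label_lt_label_iff.1 h).of_mem_node hL hx hz hy)
  have hxy : x ≠ y := fun h => hy (h ▸ hx)
  have hzy : z ≠ y := fun h => hy (h ▸ hz)
  constructor
  · intro h
    exact (D.label_lt_or_lt hzy).resolve_left fun h' => lt_asymm h (aux hz hx h')
  · intro h
    exact (D.label_lt_or_lt hxy).resolve_left fun h' => lt_asymm h (aux hx hz h')

/-- Nodes are intervals of the drawing; most later inclusions between common ancestors come from
this. -/
theorem mem_node_of_between {L : Finset α} (hL : L ∈ S.nodes) {x y z : α} (hx : x ∈ L) (hz : z ∈ L)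
    (hxy : D.label x ≤ D.label y) (hyz : D.label y ≤ D.label z) : y ∈ L := by
  by_contra hy
  rcases hxy.lt_or_eq with h | h
  · rcases hyz.lt_or_eq with h' | h'
    · exact lt_asymm h ((label_lt_iff_of_mem_node hL hx hz hy).2 h')
    · exact hy (D.label_injective h' ▸ hz)
  · exact hy (D.label_injective h ▸ hx)

theorem pre_eq_some_iff {J : Finset α} {y a : α} : D.pre J y = some a ↔
    a ∈ J ∧ D.label a < D.label y ∧ ∀ b ∈ J, D.label b < D.label y → D.label b ≤ D.label a := by
  have key : ∀ {a}, D.pre J y = some a →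
      a ∈ J ∧ D.label a < D.label y ∧ ∀ b ∈ J, D.label b < D.label y → D.label b ≤ D.label a := by
    intro a h
    have hm := List.argmax_mem (Option.mem_def.2 h)
    rw [mem_toList, mem_filter] at hm
    exact ⟨hm.1, hm.2, fun b hb hlt =>
      List.le_of_mem_argmax (mem_toList.2 (mem_filter.2 ⟨hb, hlt⟩)) (Option.mem_def.2 h)⟩
  refine ⟨key, fun ⟨ha, hlt, hmax⟩ => ?_⟩
  cases h : D.pre J y with
  | none =>
    have := List.argmax_eq_none.1 h
    rw [toList_eq_nil, filter_eq_empty_iff] at this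
    exact absurd hlt (this ha)
  | some b =>
    obtain ⟨hb, hblt, hbmax⟩ := key h
    exact congrArg some (D.label_injective (le_antisymm (hmax b hb hblt) (hbmax a ha hlt)))

theorem pre_eq_none_iff {J : Finset α} {y : α} : D.pre J y = none ↔
    ∀ b ∈ J, ¬ D.label b < D.label y := by
  rw [pre, List.argmax_eq_none, toList_eq_nil, filter_eq_empty_iff]

theorem nex_eq_some_iff {J : Finset α} {y a : α} : D.nex J y = some a ↔
    a ∈ J ∧ D.label y < D.label a ∧ ∀ b ∈ J, D.label y < D.label b → D.label a ≤ D.label b := by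
  have key : ∀ {a}, D.nex J y = some a →
      a ∈ J ∧ D.label y < D.label a ∧ ∀ b ∈ J, D.label y < D.label b → D.label a ≤ D.label b := by
    intro a h
    have hm := List.argmin_mem (Option.mem_def.2 h)
    rw [mem_toList, mem_filter] at hm
    exact ⟨hm.1, hm.2, fun b hb hlt =>
      List.le_of_mem_argmin (mem_toList.2 (mem_filter.2 ⟨hb, hlt⟩)) (Option.mem_def.2 h)⟩
  refine ⟨key, fun ⟨ha, hlt, hmax⟩ => ?_⟩
  cases h : D.nex J y with
  | none =>
    have := List.argmin_eq_none.1 h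
    rw [toList_eq_nil, filter_eq_empty_iff] at this
    exact absurd hlt (this ha)
  | some b =>
    obtain ⟨hb, hblt, hbmax⟩ := key h
    exact congrArg some (D.label_injective (le_antisymm (hbmax a ha hlt) (hmax b hb hblt)))

theorem nex_eq_none_iff {J : Finset α} {y : α} : D.nex J y = none ↔
    ∀ b ∈ J, ¬ D.label y < D.label b := by
  rw [nex, List.argmin_eq_none, toList_eq_nil, filter_eq_empty_iff]

/-- The elements `x` and `y` lie in the same gap of `J`. -/
def SameGap (D : S.Drawing) (J : Finset α) (x y : α) : Prop :=
  ∀ c ∈ J, D.label c < D.label x ↔ D.label c < D.label y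

theorem SameGap.pre_eq {J : Finset α} {x y : α} (h : D.SameGap J x y) : D.pre J x = D.pre J y := by
  rw [pre, pre, filter_congr h]

/-- `SameGap` compares only what lies strictly to the left, so it also holds for the right endpoint
of a gap, which belongs to J. Staying outside J makes the right-hand sides agree as well. -/
theorem SameGap.nex_eq {J : Finset α} {x y : α} (h : D.SameGap J x y) (hx : x ∉ J) (hy : y ∉ J) :
    D.nex J x = D.nex J y := by
  have : ∀ c ∈ J, D.label x < D.label c ↔ D.label y < D.label c := by
    intro c hc
    have h1 := h c hc
    have h2 := D.label_lt_or_lt (fun e => hx (e ▸ hc) : c ≠ x)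
    have h3 := D.label_lt_or_lt (fun e => hy (e ▸ hc) : c ≠ y)
    omega
  rw [nex, nex, filter_congr this]

theorem join_some_lt_join_none {y a : α} : S.join y (some a) < S.join y none := WithTop.coe_lt_top _

theorem join_some_lt_join_some {y a b : α} :
    S.join y (some a) < S.join y (some b) ↔ S.lca y a ⊂ S.lca y b :=
  WithTop.coe_lt_coe

/-- Two vertices that are ancestors of the same terminal are comparable. -/
theorem join_le_join_of_not_lt {y : α} {u v : Option α} (h : ¬ S.join y u < S.join y v) :
    S.join y v ≤ S.join y u := by
  cases u with
  | none => exact le_top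
  | some a =>
    cases v with
    | none => exact absurd join_some_lt_join_none h
    | some b =>
      rw [join_some_lt_join_some] at h
      rcases nodes_comparable (lca_mem_nodes (S := S) y a) (lca_mem_nodes y b) (left_mem_lca y a)
        (left_mem_lca y b) with h' | h'
      · rcases eq_or_ne (S.lca y a) (S.lca y b) with e | e
        · exact WithTop.coe_le_coe.2 e.ge
        · exact absurd (h'.ssubset_of_ne e) h
      · exact WithTop.coe_le_coe.2 h'

theorem rep_of_notMem {J : Finset α} {y : α} (hy : y ∉ J) : D.rep J y =
    if S.join y (D.pre J y) < S.join y (D.nex J y) then D.pre J y else D.nex J y := by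
  rw [rep, if_neg hy]

theorem exists_rep_eq_some {J : Finset α} (hJ : J.Nonempty) (D : S.Drawing) (y : α) :
    ∃ a ∈ J, D.rep J y = some a := by
  by_cases hy : y ∈ J
  · exact ⟨y, hy, by rw [rep, if_pos hy]⟩
  rw [rep_of_notMem hy]
  cases hp : D.pre J y with
  | none =>
    cases hn : D.nex J y with
    | none =>
      obtain ⟨c, hc⟩ := hJ
      have h1 := pre_eq_none_iff.1 hp c hc
      have h2 := nex_eq_none_iff.1 hn c hc
      exact absurd (D.label_lt_or_lt (fun e => hy (e ▸ hc) : c ≠ y)) (by tauto)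
    | some b =>
      exact ⟨b, (nex_eq_some_iff.1 hn).1, by simp [join]⟩
  | some a =>
    cases hn : D.nex J y with
    | none => exact ⟨a, (pre_eq_some_iff.1 hp).1, by rw [if_pos join_some_lt_join_none]⟩
    | some b =>
      split_ifs
      · exact ⟨a, (pre_eq_some_iff.1 hp).1, rfl⟩
      · exact ⟨b, (nex_eq_some_iff.1 hn).1, rfl⟩

theorem join_rep_le {J : Finset α} {y : α} (hy : y ∉ J) :
    S.join y (D.rep J y) ≤ S.join y (D.pre J y) ∧ S.join y (D.rep J y) ≤ S.join y (D.nex J y) := by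
  rw [rep_of_notMem hy]
  split_ifs with h
  · exact ⟨le_rfl, h.le⟩
  · exact ⟨join_le_join_of_not_lt h, le_rfl⟩

/-- For y outside J, the neighbour of y on the side of c lies between y and c, hence in the interval
L. The common ancestor of y with its representative is no higher, so it too is inside L. -/
theorem rep_mem_node {J L : Finset α} (hL : L ∈ S.nodes) {y a c : α} (hy : y ∈ L) (hc : c ∈ J)
    (hcL : c ∈ L) (h : D.rep J y = some a) : a ∈ J ∧ a ∈ L := by
  obtain ⟨a', ha', h'⟩ := exists_rep_eq_some ⟨c, hc⟩ D y
  obtain rfl : a' = a := Option.some.inj (h'.symm.trans h)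
  refine ⟨ha', ?_⟩
  by_cases hyJ : y ∈ J
  · rw [rep, if_pos hyJ] at h
    exact Option.some.inj h ▸ hy
  have hle := join_rep_le (D := D) hyJ
  rw [h] at hle
  suffices hs : ∃ b ∈ L, S.join y (some a') ≤ S.join y (some b) by
    obtain ⟨b, hb, hs⟩ := hs
    exact lca_subset hL hy hb (WithTop.coe_le_coe.1 hs (right_mem_lca y a'))
  rcases D.label_lt_or_lt (fun e => hyJ (e ▸ hc) : c ≠ y) with hlt | hlt
  · cases hp : D.pre J y with
    | none => exact absurd hlt (pre_eq_none_iff.1 hp c hc)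
    | some b =>
      obtain ⟨_, hb, hmax⟩ := pre_eq_some_iff.1 hp
      exact ⟨b, mem_node_of_between (D := D) hL hcL hy (hmax c hc hlt) hb.le, hp ▸ hle.1⟩
  · cases hp : D.nex J y with
    | none => exact absurd hlt (nex_eq_none_iff.1 hp c hc)
    | some b =>
      obtain ⟨_, hb, hmax⟩ := nex_eq_some_iff.1 hp
      exact ⟨b, mem_node_of_between (D := D) hL hy hcL hb.le (hmax c hc hlt), hp ▸ hle.2⟩

/-- L lies in one gap of J, so its elements have the same neighbours. A common ancestor with a point
outside L contains L, so it does not depend on the element chosen in L. -/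
theorem rep_eq_of_mem_node {J L : Finset α} (hL : L ∈ S.nodes) (hJL : ∀ c ∈ J, c ∉ L) {x y : α}
    (hx : x ∈ L) (hy : y ∈ L) : D.rep J x = D.rep J y := by
  have hxJ : x ∉ J := fun h => hJL x h hx
  have hyJ : y ∉ J := fun h => hJL y h hy
  have hgap : D.SameGap J x y := fun c hc => label_lt_iff_of_mem_node hL hx hy (hJL c hc)
  have hjoin : ∀ u : Option α, (∀ c, u = some c → c ∈ J) → S.join x u = S.join y u := by
    intro u hu
    cases u with
    | none => rfl
    | some c =>
      have hc := hJL c (hu c rfl)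
      have aux : ∀ {x y : α}, x ∈ L → y ∈ L → S.lca x c ⊆ S.lca y c := by
        intro x y hx hy
        refine lca_subset (lca_mem_nodes y c) ?_ (right_mem_lca y c)
        rcases nodes_comparable hL (lca_mem_nodes y c) hy (left_mem_lca y c) with h | h
        · exact h hx
        · exact absurd (h (right_mem_lca y c)) hc
      exact congrArg _ ((aux hx hy).antisymm (aux hy hx))
  rw [rep_of_notMem hxJ, rep_of_notMem hyJ, hgap.pre_eq, hgap.nex_eq hxJ hyJ,
    hjoin _ fun c h => (pre_eq_some_iff.1 h).1, hjoin _ fun c h => (nex_eq_some_iff.1 h).1]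

/-- A set whose elements have distinct representatives in a non-empty independent set is
independent. -/
theorem indep_of_injOn_rep {J A : Finset α} (hJ : S.Indep J) (hne : J.Nonempty)
    (hA : Set.InjOn (D.rep J) A) : S.Indep A := by
  classical
  intro L hL
  have hLn := mem_nodes_of_mem_sets hL
  rw [← coe_inter, Set.ncard_coe_finset]
  by_cases hJL : ∃ c ∈ J, c ∈ L
  · obtain ⟨c, hc, hcL⟩ := hJL
    refine le_trans ?_ (hJ L hL)
    rw [← coe_inter, Set.ncard_coe_finset, ← card_image_of_injective (J ∩ L) (Option.some_injective α)]
    refine card_le_card_of_injOn (D.rep J) (fun x hx => ?_)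
      (hA.mono (by simp))
    have hxL := (mem_inter.1 hx).2
    obtain ⟨a, -, ha⟩ := exists_rep_eq_some hne D x
    rw [ha]
    exact mem_coe.2 (mem_image_of_mem _ (mem_inter.2 (rep_mem_node hLn hxL hc hcL ha)))
  · push Not at hJL
    refine le_trans (card_le_one.2 fun x hx y hy => ?_) (S.cap_pos L hL)
    rw [mem_inter] at hx hy
    exact hA hx.1 hy.1 (rep_eq_of_mem_node hLn hJL hx.2 hy.2)

end Drawing

end Tree

end LaminarSystem

/-! ### The three forbidden elements. -/

namespace LaminarSystem

namespace Drawing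

section Forbidden

variable {α : Type*} [Fintype α] [DecidableEq α] {S : LaminarSystem α} {D : S.Drawing}

open Classical in
/-- The third forbidden element for `r` with respect to `K`: the neighbour in `K` of the
representative of `r`, on the side opposite to `r`. -/
noncomputable def outerNeighbour (D : S.Drawing) (K : Finset α) (r : α) : Option α :=
  if S.join r (D.pre K r) < S.join r (D.nex K r) then (D.pre K r).bind (D.pre K)
  else (D.nex K r).bind (D.nex K)

/-- The elements of `K` that are forbidden for `r`. -/
noncomputable def forbidden (D : S.Drawing) (K : Finset α) (r : α) : Finset α :=
  (D.pre K r).toFinset ∪ (D.nex K r).toFinset ∪ (D.outerNeighbour K r).toFinset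

theorem mem_forbidden {K : Finset α} {r x : α} : x ∈ D.forbidden K r ↔
    D.pre K r = some x ∨ D.nex K r = some x ∨ D.outerNeighbour K r = some x := by
  simp [forbidden]

theorem forbidden_subset (D : S.Drawing) (K : Finset α) (r : α) : D.forbidden K r ⊆ K := by
  intro x hx
  rcases mem_forbidden.1 hx with h | h | h
  · exact (pre_eq_some_iff.1 h).1
  · exact (nex_eq_some_iff.1 h).1
  · rw [outerNeighbour] at h
    split_ifs at h
    · obtain ⟨a, -, h⟩ := Option.bind_eq_some_iff.1 h
      exact (pre_eq_some_iff.1 h).1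
    · obtain ⟨a, -, h⟩ := Option.bind_eq_some_iff.1 h
      exact (nex_eq_some_iff.1 h).1

theorem card_forbidden_le (D : S.Drawing) (K : Finset α) (r : α) : (D.forbidden K r).card ≤ 3 := by
  have h : ∀ o : Option α, o.toFinset.card ≤ 1 := by
    intro o
    cases o <;> simp
  calc _ ≤ _ := card_union_le _ _
    _ ≤ 1 + 1 + 1 := Nat.add_le_add ((card_union_le _ _).trans (Nat.add_le_add (h _) (h _))) (h _)

theorem mem_forbidden_singleton {x r : α} (h : x ≠ r) : x ∈ D.forbidden {x} r := by
  rw [mem_forbidden]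
  rcases D.label_lt_or_lt h with h | h
  · exact Or.inl (pre_eq_some_iff.2 ⟨mem_singleton_self x, h, fun b hb _ => by
      rw [mem_singleton.1 hb]⟩)
  · exact Or.inr (Or.inl (nex_eq_some_iff.2 ⟨mem_singleton_self x, h, fun b hb _ => by
      rw [mem_singleton.1 hb]⟩))

/-- If all elements of `K` other than `x` are in `J` or in another gap than `r`, then each of them
is separated from `r` by an element of `J`, possibly itself. -/
theorem exists_mem_between {J K : Finset α} {r x b : α} (hr : r ∉ J)
    (hK : ∀ b ∈ K, b ≠ x → b ∈ J ∨ ¬ D.SameGap J r b) (hb : b ∈ K) (hbx : b ≠ x) :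
    (D.label b < D.label r → ∃ c ∈ J, D.label b ≤ D.label c ∧ D.label c < D.label r) ∧
    (D.label r < D.label b → ∃ c ∈ J, D.label r < D.label c ∧ D.label c ≤ D.label b) := by
  rcases hK b hb hbx with h | h
  · exact ⟨fun hlt => ⟨b, h, le_rfl, hlt⟩, fun hlt => ⟨b, h, hlt, le_rfl⟩⟩
  · rw [SameGap] at h
    push Not at h
    obtain ⟨c, hc, h⟩ := h
    have := D.label_lt_or_lt (fun e => hr (e ▸ hc) : c ≠ r)
    exact ⟨fun hlt => ⟨c, hc, by omega, by omega⟩, fun hlt => ⟨c, hc, by omega, by omega⟩⟩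

theorem mem_forbidden_of_sameGap {J K : Finset α} {r x : α} (hr : r ∉ J) (hxJ : x ∉ J) (hx : x ∈ K)
    (hxr : x ≠ r) (hK : ∀ b ∈ K, b ≠ x → b ∈ J ∨ ¬ D.SameGap J r b) (hgap : D.SameGap J r x) :
    x ∈ D.forbidden K r := by
  rw [mem_forbidden]
  rcases D.label_lt_or_lt hxr with h | h
  · refine Or.inl (pre_eq_some_iff.2 ⟨hx, h, fun b hb hlt => ?_⟩)
    by_contra hxb
    obtain ⟨c, hc, h1, h2⟩ := (exists_mem_between hr hK hb (by rintro rfl; omega)).1 hlt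
    have := hgap c hc
    omega
  · refine Or.inr (Or.inl (nex_eq_some_iff.2 ⟨hx, h, fun b hb hlt => ?_⟩))
    by_contra hxb
    obtain ⟨c, hc, h1, h2⟩ := (exists_mem_between hr hK hb (by rintro rfl; omega)).2 hlt
    have := hgap c hc
    have := D.label_lt_or_lt (fun e => hxJ (e ▸ hc) : c ≠ x)
    omega

/-- With x on the left of r, any element of K to the right of r has an element of J at or before it.
So if J prefers the left neighbour, K does too, and `outerNeighbour` looks on the intended side. -/
theorem join_nex_le {J K : Finset α} {r x : α} (hr : r ∉ J) (hxr : D.label x < D.label r)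
    (hK : ∀ b ∈ K, b ≠ x → b ∈ J ∨ ¬ D.SameGap J r b) :
    S.join r (D.nex J r) ≤ S.join r (D.nex K r) := by
  cases hn : D.nex K r with
  | none => exact le_top
  | some d =>
    obtain ⟨hd, hrd, -⟩ := nex_eq_some_iff.1 hn
    obtain ⟨c, hc, hrc, hcd⟩ := (exists_mem_between hr hK hd (by rintro rfl; omega)).2 hrd
    cases he : D.nex J r with
    | none => exact absurd hrc (nex_eq_none_iff.1 he c hc)
    | some e =>
      obtain ⟨-, hre, hmin⟩ := nex_eq_some_iff.1 he
      exact WithTop.coe_le_coe.2 (lca_subset (lca_mem_nodes r d) (left_mem_lca r d)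
        (mem_node_of_between (D := D) (lca_mem_nodes r d) (left_mem_lca r d) (right_mem_lca r d)
          hre.le ((hmin c hc hrc).trans hcd)))

theorem join_pre_le {J K : Finset α} {r x : α} (hr : r ∉ J) (hxr : D.label r < D.label x)
    (hK : ∀ b ∈ K, b ≠ x → b ∈ J ∨ ¬ D.SameGap J r b) :
    S.join r (D.pre J r) ≤ S.join r (D.pre K r) := by
  cases hn : D.pre K r with
  | none => exact le_top
  | some d =>
    obtain ⟨hd, hrd, -⟩ := pre_eq_some_iff.1 hn
    obtain ⟨c, hc, hdc, hcr⟩ := (exists_mem_between hr hK hd (by rintro rfl; omega)).1 hrd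
    cases he : D.pre J r with
    | none => exact absurd hcr (pre_eq_none_iff.1 he c hc)
    | some e =>
      obtain ⟨-, hre, hmax⟩ := pre_eq_some_iff.1 he
      exact WithTop.coe_le_coe.2 (lca_subset (lca_mem_nodes r d) (left_mem_lca r d)
        (mem_node_of_between (D := D) (lca_mem_nodes r d) (right_mem_lca r d) (left_mem_lca r d)
          (hdc.trans (hmax c hc hcr)) hre.le))

/-- If the right neighbour represents `x`, it also represents everything in between. -/
theorem rep_eq_of_between_nex {J : Finset α} {x a b : α} (hx : x ∉ J) (hb : b ∉ J)
    (hn : D.nex J x = some a) (hlt : ¬ S.join x (D.pre J x) < S.join x (some a))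
    (hxb : D.label x < D.label b) (hba : D.label b < D.label a) : D.rep J b = some a := by
  obtain ⟨haJ, hxa, hmin⟩ := nex_eq_some_iff.1 hn
  have hgap : D.SameGap J b x := by
    intro c hc
    have := hmin c hc
    have := D.label_lt_or_lt (fun e => hx (e ▸ hc) : c ≠ x)
    omega
  rw [rep_of_notMem hb, hgap.pre_eq, hgap.nex_eq hb hx, hn]
  refine if_neg fun h => hlt ?_
  cases hp : D.pre J x with
  | none =>
    rw [hp] at h
    exact absurd h not_top_lt
  | some c =>
    rw [hp] at h
    obtain ⟨-, hcx, -⟩ := pre_eq_some_iff.1 hp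
    rw [join_some_lt_join_some] at h ⊢
    -- Moving from x to b, away from c and towards a, can only raise the common ancestor with c and
    -- lower the one with a.
    have h1 : S.lca x c ⊆ S.lca b c := lca_subset (lca_mem_nodes b c)
      (mem_node_of_between (D := D) (lca_mem_nodes b c) (right_mem_lca b c) (left_mem_lca b c)
        hcx.le hxb.le) (right_mem_lca b c)
    have h2 : S.lca b a ⊆ S.lca x a := lca_subset (lca_mem_nodes x a)
      (mem_node_of_between (D := D) (lca_mem_nodes x a) (left_mem_lca x a) (right_mem_lca x a)
        hxb.le hba.le) (right_mem_lca x a)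
    exact (h1.trans_ssubset h).trans_subset h2

/-- If the left neighbour represents `x`, it also represents everything in between. -/
theorem rep_eq_of_between_pre {J : Finset α} {x a b : α} (hx : x ∉ J) (hb : b ∉ J)
    (hp : D.pre J x = some a) (hlt : S.join x (some a) < S.join x (D.nex J x))
    (hab : D.label a < D.label b) (hbx : D.label b < D.label x) : D.rep J b = some a := by
  obtain ⟨haJ, hax, hmax⟩ := pre_eq_some_iff.1 hp
  have hgap : D.SameGap J b x := by
    intro c hc
    have := hmax c hc
    have := D.label_lt_or_lt (fun e => hx (e ▸ hc) : c ≠ x)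
    omega
  rw [rep_of_notMem hb, hgap.pre_eq, hgap.nex_eq hb hx, hp]
  refine if_pos ?_
  cases hn : D.nex J x with
  | none => exact join_some_lt_join_none
  | some c =>
    rw [hn] at hlt
    obtain ⟨-, hxc, -⟩ := nex_eq_some_iff.1 hn
    rw [join_some_lt_join_some] at hlt ⊢
    have h1 : S.lca x c ⊆ S.lca b c := lca_subset (lca_mem_nodes b c)
      (mem_node_of_between (D := D) (lca_mem_nodes b c) (left_mem_lca b c) (right_mem_lca b c)
        hbx.le hxc.le) (right_mem_lca b c)
    have h2 : S.lca b a ⊆ S.lca x a := lca_subset (lca_mem_nodes x a)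
      (mem_node_of_between (D := D) (lca_mem_nodes x a) (right_mem_lca x a) (left_mem_lca x a)
        hab.le hbx.le) (right_mem_lca x a)
    exact (h2.trans_ssubset hlt).trans_subset h1

/-- Being represented by a from another gap, x must lie across a, in the order x, a, r. Nothing of K
but possibly a lies between x and r, so x is the left neighbour of r in K or the second one. -/
theorem mem_forbidden_of_rep_eq_pre {J K : Finset α} {r x a : α} (hr : r ∉ J) (hxJ : x ∉ J)
    (hx : x ∈ K) (hK : ∀ b ∈ K, b ≠ x → b ∈ J ∨ ¬ D.SameGap J r b ∧ D.rep J b ≠ some a)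
    (hgap : ¬ D.SameGap J r x) (hp : D.pre J r = some a)
    (hlt : S.join r (some a) < S.join r (D.nex J r)) (hrep : D.rep J x = some a) :
    x ∈ D.forbidden K r := by
  have hK' : ∀ b ∈ K, b ≠ x → b ∈ J ∨ ¬ D.SameGap J r b := fun b hb h =>
    (hK b hb h).imp_right And.left
  obtain ⟨haJ, har, hmax⟩ := pre_eq_some_iff.1 hp
  have hxa : D.label x < D.label a ∧ D.nex J x = some a ∧
      ¬ S.join x (D.pre J x) < S.join x (some a) := by
    rw [rep_of_notMem hxJ] at hrep
    split_ifs at hrep with h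
    · obtain ⟨-, hax, hmax'⟩ := pre_eq_some_iff.1 hrep
      refine absurd (fun c hc => ?_) hgap
      have := hmax c hc
      have := hmax' c hc
      omega
    · rw [hrep] at h
      exact ⟨(nex_eq_some_iff.1 hrep).2.1, hrep, h⟩
  obtain ⟨hxa, hn, hnlt⟩ := hxa
  obtain ⟨-, -, hmin⟩ := nex_eq_some_iff.1 hn
  -- Outside J, a point between x and a would also be represented by a, and a point between a and r
  -- would be in the gap of r; both are excluded for K.
  have hbetween : ∀ b ∈ K, D.label x < D.label b → D.label b < D.label r → b = a := by
    intro b hb hxb hbr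
    refine D.label_injective ?_
    rcases hK b hb (by rintro rfl; omega) with h | ⟨h1, h2⟩
    · exact le_antisymm (hmax b h hbr) (hmin b h hxb)
    · by_contra hne
      rcases lt_or_gt_of_ne hne with h | h
      · refine h2 (rep_eq_of_between_nex hxJ (fun hbJ => ?_) hn hnlt hxb h)
        have := hmin b hbJ hxb
        omega
      · refine h1 fun c hc => ?_
        have := hmax c hc
        omega
  rw [mem_forbidden]
  -- The representative may have dropped out of the optimum since the sample; then x itself is
  -- adjacent to r.
  by_cases haK : a ∈ K
  · have hpK : D.pre K r = some a := by
      refine pre_eq_some_iff.2 ⟨haK, har, fun b hb hbr => ?_⟩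
      by_contra hab
      have := hbetween b hb (by omega) hbr
      simp [this] at hab
    refine Or.inr (Or.inr ?_)
    rw [outerNeighbour, hpK, if_pos (hlt.trans_le (join_nex_le hr (hxa.trans har) hK')),
      Option.bind_some]
    refine pre_eq_some_iff.2 ⟨hx, hxa, fun b hb hba => ?_⟩
    by_contra hxb
    have := hbetween b hb (by omega) (by omega)
    simp [this] at hba
  · refine Or.inl (pre_eq_some_iff.2 ⟨hx, hxa.trans har, fun b hb hbr => ?_⟩)
    by_contra hxb
    exact haK (hbetween b hb (by omega) hbr ▸ hb)

theorem mem_forbidden_of_rep_eq_nex {J K : Finset α} {r x a : α} (hr : r ∉ J) (hxJ : x ∉ J)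
    (hx : x ∈ K) (hK : ∀ b ∈ K, b ≠ x → b ∈ J ∨ ¬ D.SameGap J r b ∧ D.rep J b ≠ some a)
    (hgap : ¬ D.SameGap J r x) (hn : D.nex J r = some a)
    (hlt : ¬ S.join r (D.pre J r) < S.join r (some a)) (hrep : D.rep J x = some a) :
    x ∈ D.forbidden K r := by
  have hK' : ∀ b ∈ K, b ≠ x → b ∈ J ∨ ¬ D.SameGap J r b := fun b hb h =>
    (hK b hb h).imp_right And.left
  obtain ⟨haJ, hra, hmin⟩ := nex_eq_some_iff.1 hn
  have hxa : D.label a < D.label x ∧ D.pre J x = some a ∧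
      S.join x (some a) < S.join x (D.nex J x) := by
    rw [rep_of_notMem hxJ] at hrep
    split_ifs at hrep with h
    · rw [hrep] at h
      exact ⟨(pre_eq_some_iff.1 hrep).2.1, hrep, h⟩
    · obtain ⟨-, hxa, hmin'⟩ := nex_eq_some_iff.1 hrep
      refine absurd (fun c hc => ?_) hgap
      have := hmin c hc
      have := hmin' c hc
      have := D.label_lt_or_lt (fun e => hxJ (e ▸ hc) : c ≠ x)
      have := D.label_lt_or_lt (fun e => hr (e ▸ hc) : c ≠ r)
      omega
  obtain ⟨hax, hp, hplt⟩ := hxa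
  obtain ⟨-, -, hmax⟩ := pre_eq_some_iff.1 hp
  have hbetween : ∀ b ∈ K, D.label r < D.label b → D.label b < D.label x → b = a := by
    intro b hb hrb hbx
    refine D.label_injective ?_
    rcases hK b hb (by rintro rfl; omega) with h | ⟨h1, h2⟩
    · exact le_antisymm (hmax b h hbx) (hmin b h hrb)
    · by_contra hne
      rcases lt_or_gt_of_ne hne with h | h
      · refine h1 fun c hc => ?_
        have := hmin c hc
        have := D.label_lt_or_lt (fun e => hr (e ▸ hc) : c ≠ r)
        omega
      · refine h2 (rep_eq_of_between_pre hxJ (fun hbJ => ?_) hp hplt h hbx)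
        have := hmax b hbJ hbx
        omega
  rw [mem_forbidden]
  by_cases haK : a ∈ K
  · have hnK : D.nex K r = some a := by
      refine nex_eq_some_iff.2 ⟨haK, hra, fun b hb hrb => ?_⟩
      by_contra hab
      have := hbetween b hb hrb (by omega)
      simp [this] at hab
    refine Or.inr (Or.inr ?_)
    rw [outerNeighbour, hnK,
      if_neg (fun h => hlt ((join_pre_le hr (hra.trans hax) hK').trans_lt h)), Option.bind_some]
    refine nex_eq_some_iff.2 ⟨hx, hax, fun b hb hab => ?_⟩
    by_contra hbx
    have := hbetween b hb (by omega) (by omega)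
    simp [this] at hab
  · refine Or.inr (Or.inl (nex_eq_some_iff.2 ⟨hx, hra.trans hax, fun b hb hrb => ?_⟩))
    by_contra hbx
    exact haK (hbetween b hb hrb (by omega) ▸ hb)

/-- If `x` is the first element of `K` outside `J` that lies in the gap of `r` or shares the
representative of `r`, then `x` is forbidden for `r`. -/
theorem mem_forbidden_of_first {J K : Finset α} {r x : α} (hne : J.Nonempty) (hr : r ∉ J)
    (hxJ : x ∉ J) (hx : x ∈ K) (hxr : x ≠ r)
    (hK : ∀ b ∈ K, b ≠ x → b ∈ J ∨ ¬ D.SameGap J r b ∧ D.rep J b ≠ D.rep J r)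
    (hbad : D.SameGap J r x ∨ D.rep J x = D.rep J r) : x ∈ D.forbidden K r := by
  by_cases hgap : D.SameGap J r x
  · exact mem_forbidden_of_sameGap hr hxJ hx hxr
      (fun b hb h => (hK b hb h).imp_right And.left) hgap
  have hrep := hbad.resolve_left hgap
  obtain ⟨a, -, ha⟩ := exists_rep_eq_some hne D r
  rw [ha] at hK hrep
  rw [rep_of_notMem hr] at ha
  split_ifs at ha with h
  · rw [ha] at h
    exact mem_forbidden_of_rep_eq_pre hr hxJ hx hK hgap ha h hrep
  · rw [ha] at h
    exact mem_forbidden_of_rep_eq_nex hr hxJ hx hK hgap ha h hrep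

end Forbidden

end Drawing

end LaminarSystem

/-! ### The greedy optimum of a matroid. -/

section Greedy

variable {α : Type*} [LinearOrder α] {M : Matroid α}

open Classical in
-- The invariant is the closure: a rejected element is already spanned by the kept ones.
theorem foldl_greedy_spec (l : List α) (hE : M.E = Set.univ) (I : Finset α)
    (hI : M.Indep I) : ∃ K : Finset α,
    l.foldl (fun (I : Finset α) e => if M.Indep (insert e (I : Set α)) then insert e I else I) I = K ∧
    M.Indep K ∧ I ⊆ K ∧ (∀ x ∈ K, x ∈ I ∨ x ∈ l) ∧
    M.closure (K : Set α) = M.closure (I ∪ {x | x ∈ l}) := by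
  induction l generalizing I with
  | nil => exact ⟨I, rfl, hI, subset_rfl, fun x hx => Or.inl hx, by simp⟩
  | cons a l ih =>
    rw [List.foldl_cons]
    split_ifs with h
    · obtain ⟨K, hK, hKi, hsub, hmem, hcl⟩ := ih (insert a I) (by simpa using h)
      refine ⟨K, hK, hKi, (subset_insert a I).trans hsub, fun x hx => ?_, ?_⟩
      · rcases hmem x hx with h | h
        · rcases mem_insert.1 h with rfl | h
          · simp
          · exact Or.inl h
        · exact Or.inr (List.mem_cons_of_mem _ h)
      · rw [hcl]
        congr 1
        ext x
        simp only [coe_insert, Set.mem_union, Set.mem_insert_iff, mem_coe, Set.mem_ofPred_eq,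
          List.mem_cons]
        tauto
    · obtain ⟨K, hK, hKi, hsub, hmem, hcl⟩ := ih I hI
      refine ⟨K, hK, hKi, hsub, fun x hx => (hmem x hx).imp_right (List.mem_cons_of_mem _), ?_⟩
      have ha : a ∈ M.closure (I : Set α) := by
        by_contra hcon
        exact h ((hI.notMem_closure_iff (by simp [hE])).1 hcon).1
      have hset : (I : Set α) ∪ {x | x ∈ a :: l} = insert a ((I : Set α) ∪ {x | x ∈ l}) := by
        ext x
        simp only [Set.mem_union, Set.mem_insert_iff, mem_coe, Set.mem_ofPred_eq, List.mem_cons]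
        tauto
      rw [hcl, hset, M.closure_insert_eq_of_mem_closure
        (M.closure_subset_closure Set.subset_union_left ha)]

theorem greedyOpt_subset (hE : M.E = Set.univ) (Q : Finset α) : greedyOpt M Q ⊆ Q := by
  obtain ⟨K, hK, -, -, hmem, -⟩ := foldl_greedy_spec (Q.sort (fun a b => b ≤ a)) hE ∅ (by simp)
  intro x hx
  have := hmem x (by rw [← hK]; exact hx)
  simpa using this

theorem indep_greedyOpt (hE : M.E = Set.univ) (Q : Finset α) : M.Indep (greedyOpt M Q : Set α) := by
  obtain ⟨K, hK, hi, -⟩ := foldl_greedy_spec (Q.sort (fun a b => b ≤ a)) hE ∅ (by simp)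
  rw [← hK] at hi
  exact hi

/-- When greedy reaches x, the kept elements span exactly what all better elements of Q span, and
later steps do not change the fate of x. In this form heredity is monotonicity of the closure. -/
theorem mem_greedyOpt_iff (hE : M.E = Set.univ) {Q : Finset α} {x : α} :
    x ∈ greedyOpt M Q ↔ x ∈ Q ∧ x ∉ M.closure {y | y ∈ Q ∧ x < y} := by
  classical
  refine (and_iff_right_of_imp fun h => greedyOpt_subset hE Q h).symm.trans
    (and_congr_right fun hx => ?_)
  obtain ⟨l₁, l₂, hl⟩ := List.append_of_mem ((Q.mem_sort (fun a b => b ≤ a)).2 hx)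
  have hsort := Q.pairwise_sort (fun a b => b ≤ a)
  have hnodup := Q.sort_nodup (fun a b => b ≤ a)
  have hmemQ : ∀ y, y ∈ Q ↔ y ∈ l₁ ∨ y = x ∨ y ∈ l₂ := by
    intro y
    rw [← Q.mem_sort (fun a b => b ≤ a), hl]
    simp
  rw [hl] at hsort hnodup
  rw [List.pairwise_append, List.pairwise_cons] at hsort
  rw [List.nodup_append, List.nodup_cons] at hnodup
  have hset : {y | y ∈ l₁} = {y | y ∈ Q ∧ x < y} := by
    ext y
    simp only [Set.mem_ofPred_eq, hmemQ]
    constructor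
    · intro hy
      exact ⟨Or.inl hy, lt_of_le_of_ne (hsort.2.2 y hy x (by simp))
        (Ne.symm (hnodup.2.2 y hy x (by simp)))⟩
    · rintro ⟨h | rfl | h, hlt⟩
      · exact h
      · exact absurd hlt (lt_irrefl _)
      · exact absurd (hsort.2.1.1 y h) hlt.not_ge
  obtain ⟨K, hK, hi, -, hmem, hcl⟩ := foldl_greedy_spec l₁ hE ∅ (by simp)
  have hxK : x ∉ K := fun h => by
    rcases hmem x h with h | h
    · simp at h
    · exact hnodup.2.2 x h x (by simp) rfl
  have hopt : greedyOpt M Q = l₂.foldl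
      (fun (I : Finset α) e => if M.Indep (insert e (I : Set α)) then insert e I else I)
      (if M.Indep (insert x (K : Set α)) then insert x K else K) := by
    rw [greedyOpt, hl, List.foldl_append, List.foldl_cons, hK]
  rw [coe_empty, Set.empty_union, hset] at hcl
  rw [← hcl, hi.notMem_closure_iff (by simp [hE]), and_iff_left (by simpa using hxK), hopt]
  split_ifs with h
  · obtain ⟨K', hK', -, hsub, -, -⟩ := foldl_greedy_spec l₂ hE (insert x K) (by simpa using h)
    rw [hK']
    exact iff_of_true (hsub (mem_insert_self x K)) h
  · obtain ⟨K', hK', -, -, hmem', -⟩ := foldl_greedy_spec l₂ hE K hi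
    rw [hK']
    refine iff_of_false (fun hx' => ?_) h
    rcases hmem' x hx' with h' | h'
    · exact hxK h'
    · exact hnodup.2.1.1 h'

theorem mem_greedyOpt_of_subset (hE : M.E = Set.univ) {P Q : Finset α} {x : α} (hPQ : P ⊆ Q)
    (hx : x ∈ greedyOpt M Q) (hxP : x ∈ P) : x ∈ greedyOpt M P := by
  rw [mem_greedyOpt_iff hE] at hx ⊢
  have hsub : {y | y ∈ P ∧ x < y} ⊆ {y | y ∈ Q ∧ x < y} := fun y hy => ⟨hPQ hy.1, hy.2⟩
  exact ⟨hxP, fun h => hx.2 (M.closure_subset_closure hsub h)⟩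

theorem greedyOpt_nonempty (hE : M.E = Set.univ) (hloop : ∀ x, M.Indep {x}) {Q : Finset α}
    (hQ : Q.Nonempty) : (greedyOpt M Q).Nonempty := by
  refine ⟨Q.max' hQ, (mem_greedyOpt_iff hE).2 ⟨Q.max'_mem hQ, ?_⟩⟩
  have : {y | y ∈ Q ∧ Q.max' hQ < y} = ∅ := by
    ext y
    simp only [Set.mem_ofPred_eq, Set.mem_empty_iff_false, iff_false, not_and, not_lt]
    exact fun hy => Q.le_max' y hy
  rw [this, M.empty_indep.notMem_closure_iff (by simp [hE])]
  simpa using hloop _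

end Greedy

/-! ### Arrival prefixes and the main loop. -/

section Arrival

variable {α : Type*} [Fintype α] {σ : Arrival α}

theorem mem_arrived {x : α} {t : ℕ} : x ∈ arrived σ t ↔ (σ.symm x : ℕ) < t := by
  simp [arrived]

theorem apply_mem_arrived {i : Fin (Fintype.card α)} {t : ℕ} : σ i ∈ arrived σ t ↔ (i : ℕ) < t := by
  simp [mem_arrived]

theorem arrived_mono {s t : ℕ} (h : s ≤ t) : arrived σ s ⊆ arrived σ t := fun _ hx =>
  mem_arrived.2 ((mem_arrived.1 hx).trans_le h)

end Arrival

section Loop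

variable {α : Type*} [Fintype α] [LinearOrder α] {S : LaminarSystem α} {D : S.Drawing}
  {J : Finset α} {σ : Arrival α}

theorem LaminarSystem.matroid_ground (S : LaminarSystem α) : S.matroid.E = Set.univ := rfl

theorem LaminarSystem.matroid_indep_iff (S : LaminarSystem α) {I : Set α} :
    S.matroid.Indep I ↔ S.Indep I := Iff.rfl

theorem LaminarSystem.indep_of_subsingleton (S : LaminarSystem α) {I : Set α}
    (hI : I.Subsingleton) : S.matroid.Indep I := fun L hL =>
  (Set.ncard_le_one_iff_subsingleton.2 (hI.anti Set.inter_subset_left)).trans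
    (S.cap_pos L hL)

theorem foldl_laminarStep_mono (l : List (Fin (Fintype.card α)))
    (st : Finset α × Finset (Option α)) : st.1 ⊆ (l.foldl (laminarStep D J σ) st).1 := by
  induction l generalizing st with
  | nil => exact subset_rfl
  | cons i l ih =>
    refine subset_trans ?_ (ih _)
    rw [laminarStep]
    split_ifs
    · exact subset_insert _ _
    · exact subset_rfl

theorem foldl_laminarStep_marked (l : List (Fin (Fintype.card α)))
    (st : Finset α × Finset (Option α)) {a : Option α}
    (ha : a ∈ (l.foldl (laminarStep D J σ) st).2) : a ∈ st.2 ∨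
      ∃ i ∈ l, σ i ∈ greedyOpt S.matroid (arrived σ (i + 1)) ∧ a = D.rep J (σ i) := by
  induction l generalizing st with
  | nil => exact Or.inl ha
  | cons i l ih =>
    rcases ih _ ha with h | ⟨j, hj, h⟩
    · rw [laminarStep] at h
      split_ifs at h with hi
      · rcases mem_insert.1 h with rfl | h
        · exact Or.inr ⟨i, List.mem_cons_self, hi.1, rfl⟩
        · exact Or.inl h
      · exact Or.inl h
    · exact Or.inr ⟨j, List.mem_cons_of_mem _ hj, h⟩

theorem foldl_laminarStep_subset (l : List (Fin (Fintype.card α)))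
    (st : Finset α × Finset (Option α)) {x : α}
    (hx : x ∈ (l.foldl (laminarStep D J σ) st).1) : x ∈ st.1 ∨ ∃ i ∈ l, x = σ i := by
  induction l generalizing st with
  | nil => exact Or.inl hx
  | cons i l ih =>
    rcases ih _ hx with h | ⟨j, hj, h⟩
    · rw [laminarStep] at h
      split_ifs at h
      · rcases mem_insert.1 h with rfl | h
        · exact Or.inr ⟨i, List.mem_cons_self, rfl⟩
        · exact Or.inl h
      · exact Or.inl h
    · exact Or.inr ⟨j, List.mem_cons_of_mem _ hj, h⟩

/-- Loop invariant: every accepted element has its representative marked, so a new one never repeats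
a representative. -/
theorem foldl_laminarStep_injOn (l : List (Fin (Fintype.card α)))
    (st : Finset α × Finset (Option α)) (hinj : Set.InjOn (D.rep J) st.1)
    (hmem : ∀ x ∈ st.1, D.rep J x ∈ st.2) :
    Set.InjOn (D.rep J) (l.foldl (laminarStep D J σ) st).1 := by
  induction l generalizing st with
  | nil => exact hinj
  | cons i l ih =>
    rw [List.foldl_cons, laminarStep]
    split_ifs with h
    · refine ih _ ?_ ?_
      · rw [coe_insert]
        intro x hx y hy hxy
        rcases hx with rfl | hx <;> rcases hy with rfl | hy
        · rfl
        · exact absurd (hxy ▸ hmem y hy) h.2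
        · exact absurd (hxy ▸ hmem x hx) h.2
        · exact hinj hx hy hxy
      · intro x hx
        rcases mem_insert.1 hx with rfl | hx
        · exact mem_insert_self _ _
        · exact mem_insert_of_mem (hmem x hx)
    · exact ih st hinj hmem

theorem mem_drop_finRange {n s : ℕ} {i : Fin n} : i ∈ (List.finRange n).drop s ↔ s ≤ (i : ℕ) := by
  rw [List.mem_drop_iff_getElem]
  constructor
  · rintro ⟨j, hj, rfl⟩
    simp
  · intro h
    refine ⟨i - s, by simp; omega, ?_⟩
    ext
    simp
    omega

theorem greedyOpt_arrived_nonempty {s : ℕ} (hs : s ≠ 0) (hn : s ≤ Fintype.card α) :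
    (greedyOpt S.matroid (arrived σ s)).Nonempty := by
  refine greedyOpt_nonempty S.matroid_ground
    (fun x => S.indep_of_subsingleton Set.subsingleton_singleton) ⟨σ ⟨0, by omega⟩, ?_⟩
  rw [apply_mem_arrived]
  exact Nat.pos_of_ne_zero hs

theorem indep_laminarOutput (D : S.Drawing) {s : ℕ} (hn : s ≤ Fintype.card α) (σ : Arrival α) :
    S.matroid.Indep (laminarOutput D s σ : Set α) := by
  rw [laminarOutput]
  split_ifs with h
  · refine S.indep_of_subsingleton fun x hx y hy => ?_
    rw [mem_coe, mem_arrived] at hx hy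
    exact σ.symm.injective (Fin.ext (by omega))
  · exact LaminarSystem.Drawing.indep_of_injOn_rep (D := D)
      (S.matroid_indep_iff.1 (indep_greedyOpt S.matroid_ground _))
      (greedyOpt_arrived_nonempty h hn)
      (foldl_laminarStep_injOn _ _ (by simp) (by simp))

theorem notMem_laminarOutput_of_mem_arrived (D : S.Drawing) {s : ℕ} (σ : Arrival α) {x : α}
    (hx : x ∈ arrived σ s) : x ∉ laminarOutput D s σ := by
  rw [mem_arrived] at hx
  rw [laminarOutput, if_neg (by omega)]
  intro h
  rcases foldl_laminarStep_subset _ _ h with h | ⟨i, hi, rfl⟩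
  · simp at h
  · rw [mem_drop_finRange] at hi
    simp at hx
    omega

theorem mem_laminarOutput_of_rep_ne {s : ℕ} (hs : s ≠ 0) {t : Fin (Fintype.card α)}
    (hst : s ≤ (t : ℕ)) (hopt : σ t ∈ greedyOpt S.matroid (arrived σ (t + 1)))
    (hrep : ∀ j : Fin (Fintype.card α), s ≤ (j : ℕ) → j < t →
      σ j ∈ greedyOpt S.matroid (arrived σ (j + 1)) →
      D.rep (greedyOpt S.matroid (arrived σ s)) (σ j) ≠
        D.rep (greedyOpt S.matroid (arrived σ s)) (σ t)) :
    σ t ∈ laminarOutput D s σ := by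
  rw [laminarOutput, if_neg hs]
  obtain ⟨l₁, l₂, hl⟩ := List.append_of_mem (mem_drop_finRange.2 hst)
  have hlt : ∀ j ∈ l₁, j < t := by
    have h := (List.pairwise_lt_finRange (Fintype.card α)).sublist (List.drop_sublist s _)
    rw [hl, List.pairwise_append] at h
    exact fun j hj => h.2.2 j hj t List.mem_cons_self
  rw [hl, List.foldl_append, List.foldl_cons]
  refine foldl_laminarStep_mono _ _ ?_
  have hmark : D.rep (greedyOpt S.matroid (arrived σ s)) (σ t) ∉
      (l₁.foldl (laminarStep D (greedyOpt S.matroid (arrived σ s)) σ) (∅, ∅)).2 := by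
    intro h
    rcases foldl_laminarStep_marked _ _ h with h | ⟨j, hj, hjopt, h⟩
    · simp at h
    · refine hrep j (mem_drop_finRange.1 ?_) (hlt j hj) hjopt h.symm
      rw [hl]
      exact List.mem_append_left _ hj
  rw [laminarStep, if_pos ⟨hopt, hmark⟩]
  exact mem_insert_self _ _

theorem mem_laminarOutput_of_not_forbidden {s : ℕ} (hs : s ≠ 0) {t : Fin (Fintype.card α)}
    (hst : s ≤ (t : ℕ)) (hopt : σ t ∈ greedyOpt S.matroid (arrived σ (t + 1)))
    (hF : ∀ j : Fin (Fintype.card α), s ≤ (j : ℕ) → j < t →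
      σ j ∉ D.forbidden (greedyOpt S.matroid (arrived σ (j + 1))) (σ t)) :
    σ t ∈ laminarOutput D s σ := by
  have hE := S.matroid_ground
  set J := greedyOpt S.matroid (arrived σ s) with hJ
  have hJmem : ∀ i : Fin (Fintype.card α), s ≤ (i : ℕ) → σ i ∉ J := fun i hi h => by
    have := apply_mem_arrived.1 (greedyOpt_subset hE _ h)
    omega
  -- Only the inequality of representatives is needed, but the induction also has to exclude the gap
  -- of r: that is what separates the other elements of K from r by elements of J.
  suffices H : ∀ (m : ℕ) (j : Fin (Fintype.card α)), (j : ℕ) = m → s ≤ (j : ℕ) → j < t →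
      σ j ∈ greedyOpt S.matroid (arrived σ (j + 1)) →
      ¬ D.SameGap J (σ t) (σ j) ∧ D.rep J (σ j) ≠ D.rep J (σ t) from
    mem_laminarOutput_of_rep_ne hs hst hopt fun j hj hjt h => (H _ j rfl hj hjt h).2
  intro m
  induction m using Nat.strong_induction_on with
  | _ m ih =>
    rintro j rfl hsj hjt hjopt
    by_contra hbad
    refine hF j hsj hjt (LaminarSystem.Drawing.mem_forbidden_of_first (J := J)
      (greedyOpt_arrived_nonempty hs (hst.trans t.2.le)) (hJmem t hst) (hJmem j hsj) hjopt
      (fun h => hjt.ne (σ.injective h)) (fun b hb hbj => ?_) (by tauto))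
    obtain ⟨i, rfl⟩ := σ.surjective b
    have hij : (i : ℕ) < j := by
      have h1 := apply_mem_arrived.1 (greedyOpt_subset hE _ hb)
      have h2 : (i : ℕ) ≠ j := fun h => hbj (congrArg σ (Fin.ext h))
      omega
    -- By heredity, b was already optimal in the sample if it belongs to it, and otherwise at its
    -- own arrival.
    rcases lt_or_ge (i : ℕ) s with his | his
    · exact Or.inl (mem_greedyOpt_of_subset hE (arrived_mono (by omega)) hb
        (apply_mem_arrived.2 his))
    · exact Or.inr (ih i hij i rfl his (lt_trans (show i < j from hij) hjt)
        (mem_greedyOpt_of_subset hE (arrived_mono (by omega)) hb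
          (apply_mem_arrived.2 (Nat.lt_succ_self i))))

theorem hasForbiddenSets_laminarAlgorithm (D : S.Drawing) (p : unitInterval) :
    HasForbiddenSets S.matroid (laminarAlgorithm D p) 3 := by
  have hE := S.matroid_ground
  refine ⟨fun s hs σ => indep_laminarOutput D hs σ, ⟨p, rfl⟩,
    fun s _ σ x hx => notMem_laminarOutput_of_mem_arrived D σ hx,
    fun X _ r => D.forbidden (greedyOpt S.matroid X) r, fun X Y r _ _ =>
      ⟨(D.forbidden_subset _ r).trans (greedyOpt_subset hE X), D.card_forbidden_le _ r⟩,
    fun s hs σ t hst hopt hF => ?_⟩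
  rcases Nat.eq_zero_or_pos s with rfl | hpos
  -- Without a sample only the first arrival is accepted. It alone forms the optimum at its arrival,
  -- so it is a neighbour of, hence forbidden for, any later element.
  · have ht : (t : ℕ) = 0 := by
      by_contra ht
      have hn : 0 < Fintype.card α := by have := t.2; omega
      have h0 : (⟨0, hn⟩ : Fin (Fintype.card α)) < t := Nat.pos_of_ne_zero ht
      refine hF ⟨0, hn⟩ le_rfl h0 ?_
      have hsub : greedyOpt S.matroid (arrived σ (0 + 1)) ⊆ {σ ⟨0, hn⟩} := by
        intro x hx
        have := mem_arrived.1 (greedyOpt_subset hE _ hx)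
        rw [mem_singleton, ← σ.symm_apply_eq]
        exact Fin.ext (by simpa using this)
      have heq := (greedyOpt_arrived_nonempty (S := S) (σ := σ) (s := 0 + 1) (by omega)
        (by omega)).subset_singleton_iff.1 hsub
      simp only [heq]
      exact LaminarSystem.Drawing.mem_forbidden_singleton fun h => h0.ne (σ.injective h)
    change σ t ∈ laminarOutput D 0 σ
    rw [laminarOutput, if_pos rfl, apply_mem_arrived]
    omega
  · exact mem_laminarOutput_of_not_forbidden hpos.ne' hst hopt hF

end Loop

/-! ### Moments of the binomial law. -/

section Binomial

theorem choose_three_real (s : ℕ) : 6 * (s.choose 3 : ℝ) = s * (s - 1) * (s - 2) := by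
  have h2 : ∀ s : ℕ, 2 * (s.choose 2 : ℝ) = s * (s - 1) := by
    intro s
    rw [Nat.cast_choose_two]
    ring
  induction s with
  | zero => simp
  | succ s ih =>
    rw [Nat.choose_succ_succ' s 2]
    push_cast
    linear_combination ih + 3 * h2 s

/-- The binomial moments of the binomial distribution. -/
theorem sum_binomial_mul_choose (n r : ℕ) (p : ℝ) :
    ∑ k ∈ Iic n, (n.choose k * p ^ k * (1 - p) ^ (n - k)) * (k.choose r : ℝ) =
      n.choose r * p ^ r := by
  have hI : Iic n = range (n + 1) := by
    ext
    simp
  rw [hI]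
  rcases lt_or_ge n r with h | h
  · rw [Nat.choose_eq_zero_of_lt h, sum_eq_zero]
    · simp
    · intro k hk
      rw [Nat.choose_eq_zero_of_lt (by rw [mem_range] at hk; omega : k < r)]
      simp
  obtain ⟨m, rfl⟩ := Nat.exists_eq_add_of_le h
  rw [add_assoc, sum_range_add, sum_eq_zero, zero_add]
  · have hb : ∑ j ∈ range (m + 1), p ^ j * (1 - p) ^ (m - j) * (m.choose j : ℝ) = 1 := by
      rw [← add_pow, add_sub_cancel, one_pow]
    refine Eq.trans ?_ ((congrArg (((r + m).choose r * p ^ r : ℝ) * ·) hb).trans (mul_one _))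
    simp only [mul_sum]
    refine sum_congr rfl fun j _ => ?_
    -- Choosing a set and then an r-subset of it, or the r-subset first; the remaining sum is the
    -- binomial theorem.
    have h1 := Nat.choose_mul (n := r + m) (k := r + j) (s := r) (by omega)
    rw [Nat.add_sub_cancel_left, Nat.add_sub_cancel_left] at h1
    have h2 : ((r + m).choose (r + j) : ℝ) * ((r + j).choose r) =
        (r + m).choose r * m.choose j := by exact_mod_cast h1
    rw [Nat.add_sub_add_left, pow_add]
    linear_combination p ^ r * p ^ j * (1 - p) ^ (m - j) * h2
  · intro k hk
    rw [Nat.choose_eq_zero_of_lt (mem_range.1 hk)]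
    simp

open Classical in
theorem binomial_real_eq_sum (n : ℕ) (p : unitInterval) (s : Set ℕ) :
    (ProbabilityTheory.binomial n p).real s =
      ∑ k ∈ Iic n, (n.choose k * (p : ℝ) ^ k * (1 - p) ^ (n - k)) * (if k ∈ s then 1 else 0) := by
  rw [← MeasureTheory.integral_indicator_one (MeasurableSet.of_discrete),
    ProbabilityTheory.integral_binomial]
  refine sum_congr rfl fun k _ => ?_
  rw [smul_eq_mul, Set.indicator_apply]
  rfl

end Binomial

/-! ### Counting arrival orders by exchangeability. -/

section Counting

variable {α : Type*} [Fintype α]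

theorem arrived_swap_trans (σ : Arrival α) {i j : Fin (Fintype.card α)} {k : ℕ} (hi : (i : ℕ) < k)
    (hj : (j : ℕ) < k) : arrived ((Equiv.swap i j).trans σ) k = arrived σ k := by
  ext x
  rw [mem_arrived, mem_arrived]
  change ((Equiv.swap i j (σ.symm x) : Fin _) : ℕ) < k ↔ _
  rcases eq_or_ne (σ.symm x) i with h | h
  · simp [h, hi, hj]
  · rcases eq_or_ne (σ.symm x) j with h' | h'
    · simp [h', hi, hj]
    · rw [Equiv.swap_apply_of_ne_of_ne h h']

variable [LinearOrder α]

/-- The arrival orders in which `e` arrives at time `t` and no element arriving at a time in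
`[m, t)` is forbidden for `e`. -/
noncomputable def goodOrders (F : Finset α → Finset α → α → Finset α) (e : α) (m : ℕ)
    (t : Fin (Fintype.card α)) : Finset (Arrival α) :=
  univ.filter fun σ => σ t = e ∧ ∀ j : Fin (Fintype.card α), m ≤ (j : ℕ) → j < t →
    σ j ∉ F (arrived σ (j + 1)) (arrived σ (t + 1)) e

variable {F : Finset α → Finset α → α → Finset α} {e : α} {m : ℕ} {t : Fin (Fintype.card α)}

theorem mem_goodOrders {σ : Arrival α} : σ ∈ goodOrders F e m t ↔
    σ t = e ∧ ∀ j : Fin (Fintype.card α), m ≤ (j : ℕ) → j < t →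
      σ j ∉ F (arrived σ (j + 1)) (arrived σ (t + 1)) e := by
  simp [goodOrders]

theorem swap_trans_mem_goodOrders {σ : Arrival α} {i j : Fin (Fintype.card α)} (hi : (i : ℕ) < m)
    (hj : (j : ℕ) < m) (hm : m ≤ t) (h : σ ∈ goodOrders F e m t) :
    (Equiv.swap i j).trans σ ∈ goodOrders F e m t := by
  rw [mem_goodOrders] at h ⊢
  have hfix : ∀ k : Fin (Fintype.card α), m ≤ (k : ℕ) → (Equiv.swap i j).trans σ k = σ k := by
    intro k hk
    rw [Equiv.trans_apply, Equiv.swap_apply_of_ne_of_ne] <;>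
    · rintro rfl
      omega
  refine ⟨(hfix t hm).trans h.1, fun k hk hkt => ?_⟩
  rw [hfix k hk, arrived_swap_trans σ (by omega) (by omega),
    arrived_swap_trans σ (by omega) (by omega)]
  exact h.2 k hk hkt

theorem card_goodOrders_self (F : Finset α → Finset α → α → Finset α) (e : α)
    (t : Fin (Fintype.card α)) :
    Fintype.card α * (goodOrders F e t t).card = Fintype.card (Arrival α) := by
  classical
  have hG : ∀ t : Fin (Fintype.card α),
      goodOrders F e t t = univ.filter fun σ : Arrival α => σ.symm e = t := by
    intro t
    ext σ
    rw [mem_goodOrders, mem_filter, Equiv.symm_apply_eq, eq_comm, and_iff_right (mem_univ _)]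
    exact ⟨And.left, fun h => ⟨h, fun j h1 h2 => absurd h2 (not_lt.2 (Fin.le_def.2 h1))⟩⟩
  -- With m = t the condition on forbidden elements is void, and swapping two times shows that e
  -- arrives equally often at each.
  have hconst : ∀ u : Fin (Fintype.card α),
      (goodOrders F e u u).card = (goodOrders F e t t).card := by
    intro u
    rw [hG, hG]
    refine card_nbij' (fun σ => (Equiv.swap t u).trans σ) (fun σ => (Equiv.swap t u).trans σ)
      ?_ ?_ ?_ ?_
    · intro σ h
      simpa [Equiv.symm_apply_eq] using h
    · intro σ h
      simpa [Equiv.symm_apply_eq] using h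
    · intro σ _
      ext
      simp
    · intro σ _
      ext
      simp
  have hsum := card_eq_sum_card_fiberwise (s := (univ : Finset (Arrival α)))
    (t := (univ : Finset (Fin (Fintype.card α)))) (f := fun σ => σ.symm e) (by simp)
  rw [sum_congr rfl fun u _ => (congrArg card (hG u).symm).trans (hconst u), sum_const, card_univ,
    card_univ, Fintype.card_fin, smul_eq_mul] at hsum
  exact hsum.symm

/-- The orders lost in passing from m + 1 to m are those whose arrival at time m is in the forbidden
set Φ. Permuting the first m + 1 arrivals changes neither Φ nor the later conditions, so each of
these m + 1 positions hits Φ in equally many orders. Since |Φ| ≤ k, double counting bounds the loss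
by a fraction k/(m + 1). -/
theorem card_goodOrders_succ {k : ℕ}
    (hF : ∀ (X Y : Finset α), e ∈ Y → X ⊆ Y.erase e → (F X Y e).card ≤ k) (hm : m < t) :
    (m + 1) * (goodOrders F e (m + 1) t).card ≤
      (m + 1) * (goodOrders F e m t).card + k * (goodOrders F e (m + 1) t).card := by
  classical
  set G := goodOrders F e (m + 1) t with hG
  let μ : Fin (Fintype.card α) := ⟨m, hm.trans t.2⟩
  let Φ : Arrival α → Finset α := fun σ => F (arrived σ (m + 1)) (arrived σ (t + 1)) e
  have hsplit : G.card = (goodOrders F e m t).card + (G.filter fun σ => σ μ ∈ Φ σ).card := by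
    rw [← card_filter_add_card_filter_not (s := G) (fun σ => σ μ ∈ Φ σ), add_comm]
    congr 2
    ext σ
    rw [mem_filter, hG, mem_goodOrders, mem_goodOrders]
    constructor
    · rintro ⟨⟨h1, h2⟩, h3⟩
      refine ⟨h1, fun j hj hjt => ?_⟩
      rcases hj.eq_or_lt with h | h
      · obtain rfl : j = μ := Fin.ext h.symm
        exact h3
      · exact h2 j h hjt
    · rintro ⟨h1, h2⟩
      exact ⟨⟨h1, fun j hj => h2 j (by omega)⟩, h2 μ le_rfl hm⟩
  let P : Finset (Fin (Fintype.card α)) := univ.filter fun i => (i : ℕ) < m + 1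
  have hP : P.card = m + 1 := by
    have : P.map Fin.valEmbedding = range (m + 1) := by
      ext k
      simp only [P, mem_map, mem_filter, mem_univ, true_and, Fin.valEmbedding_apply, mem_range]
      exact ⟨by rintro ⟨i, hi, rfl⟩; exact hi, fun hk => ⟨⟨k, by omega⟩, hk, rfl⟩⟩
    rw [← card_map Fin.valEmbedding, this, card_range]
  have hswap : ∀ i ∈ P,
      (G.filter fun σ => σ i ∈ Φ σ).card = (G.filter fun σ => σ μ ∈ Φ σ).card := by
    intro i hi
    have hi' : (i : ℕ) < m + 1 := (mem_filter.1 hi).2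
    have hΦ : ∀ σ, Φ ((Equiv.swap i μ).trans σ) = Φ σ := by
      intro σ
      simp only [Φ]
      rw [arrived_swap_trans σ hi' (Nat.lt_succ_self m),
        arrived_swap_trans σ (by omega) (show m < t + 1 by omega)]
    refine card_nbij' (fun σ => (Equiv.swap i μ).trans σ) (fun σ => (Equiv.swap i μ).trans σ)
      ?_ ?_ ?_ ?_
    · intro σ h
      rw [mem_coe, mem_filter] at h ⊢
      refine ⟨swap_trans_mem_goodOrders hi' (Nat.lt_succ_self m) hm h.1, ?_⟩
      rw [hΦ]
      simpa using h.2
    · intro σ h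
      rw [mem_coe, mem_filter] at h ⊢
      refine ⟨swap_trans_mem_goodOrders hi' (Nat.lt_succ_self m) hm h.1, ?_⟩
      rw [hΦ]
      simpa using h.2
    · intro σ _
      ext
      simp
    · intro σ _
      ext
      simp
  have hbad : (m + 1) * (G.filter fun σ => σ μ ∈ Φ σ).card ≤ k * G.card := by
    rw [← hP, ← smul_eq_mul, ← sum_const, ← sum_congr rfl hswap]
    have := sum_card_bipartiteAbove_eq_sum_card_bipartiteBelow (s := P) (t := G)
      (fun i σ => σ i ∈ Φ σ)
    simp only [bipartiteAbove, bipartiteBelow] at this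
    rw [this, mul_comm, ← smul_eq_mul, ← sum_const]
    refine sum_le_sum fun σ hσ => ?_
    rw [hG, mem_goodOrders] at hσ
    refine le_trans (card_le_card_of_injOn σ (fun i hi => (mem_filter.1 hi).2)
      σ.injective.injOn) (hF _ _ ?_ ?_)
    · rw [← hσ.1, apply_mem_arrived]
      exact Nat.lt_succ_self _
    · intro x hx
      refine mem_erase.2 ⟨?_, arrived_mono (by omega) hx⟩
      rintro rfl
      rw [← hσ.1, apply_mem_arrived] at hx
      omega
  nth_rewrite 1 [hsplit]
  rw [mul_add]
  exact Nat.add_le_add_left hbad _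

end Counting

/-! ### From forbidden sets to competitiveness. -/

section Competitive

theorem sum_filter_ge_eq_add {n s : ℕ} (hs : s < n) (u : Fin n → ℝ) :
    ∑ t ∈ univ.filter (fun t : Fin n => s ≤ (t : ℕ)), u t =
      u ⟨s, hs⟩ + ∑ t ∈ univ.filter (fun t : Fin n => s + 1 ≤ (t : ℕ)), u t := by
  have hmem : (⟨s, hs⟩ : Fin n) ∈ univ.filter (fun t : Fin n => s ≤ (t : ℕ)) :=
    mem_filter.2 ⟨mem_univ _, le_rfl⟩
  rw [← add_sum_erase _ _ hmem]
  congr 1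
  refine sum_congr ?_ fun _ _ => rfl
  ext t
  rw [mem_erase, mem_filter, mem_filter, Ne, Fin.ext_iff]
  simp
  omega

/-- The sums of a triangular array with `(s + 1) u(s, t) ≥ (s - 2) u(s + 1, t)` and constant
diagonal `c`. -/
theorem le_sum_of_recurrence {n : ℕ} (hn : 3 ≤ n) {c : ℝ} (hc : 0 ≤ c) (u : ℕ → Fin n → ℝ)
    (h0 : ∀ s t, 0 ≤ u s t) (hdiag : ∀ t : Fin n, u t t = c)
    (hstep : ∀ (s : ℕ) (t : Fin n), s < t → ((s : ℝ) - 2) * u (s + 1) t ≤ (s + 1) * u s t)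
    {s : ℕ} (hs : s ≤ n) :
    c * ((s - n / n.choose 3 * s.choose 3) / 2) ≤
      ∑ t ∈ univ.filter (fun t : Fin n => s ≤ (t : ℕ)), u s t := by
  have hC : (0 : ℝ) < n.choose 3 := by exact_mod_cast Nat.choose_pos hn
  -- In the recurrence (s + 1) g(s) = (s + 1) + (s - 2) g(s + 1), s/2 is a particular solution and
  -- s.choose 3 a homogeneous one; the coefficient n / n.choose 3 makes the bound vanish at s = n.
  induction hs using Nat.decreasingInduction with
  | self =>
    rw [div_mul_cancel₀ _ hC.ne', sub_self, zero_div, mul_zero]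
    exact sum_nonneg fun t _ => h0 _ _
  | of_succ s hs ih =>
    rw [sum_filter_ge_eq_add hs, hdiag ⟨s, hs⟩]
    have hsum : (0 : ℝ) ≤ ∑ t ∈ univ.filter (fun t : Fin n => s + 1 ≤ (t : ℕ)), u s t :=
      sum_nonneg fun t _ => h0 _ _
    -- For s ≤ 2 the factor s - 2 is not positive, but the bound is at most c and the diagonal term
    -- suffices.
    rcases le_or_gt s 2 with hs2 | hs2
    · have h1 : ((s : ℝ) - n / n.choose 3 * s.choose 3) / 2 ≤ 1 := by
        rw [Nat.choose_eq_zero_of_lt (by omega : s < 3)]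
        have : (s : ℝ) ≤ 2 := by exact_mod_cast hs2
        push_cast
        linarith
      nlinarith [mul_le_mul_of_nonneg_left h1 hc]
    · have hs2' : (0 : ℝ) ≤ (s : ℝ) - 2 := by
        have : (3 : ℝ) ≤ s := by exact_mod_cast hs2
        linarith
      have hpos : (0 : ℝ) < s + 1 := by positivity
      have hle : ((s : ℝ) - 2) * ∑ t ∈ univ.filter (fun t : Fin n => s + 1 ≤ (t : ℕ)), u (s + 1) t ≤
          (s + 1) * ∑ t ∈ univ.filter (fun t : Fin n => s + 1 ≤ (t : ℕ)), u s t := by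
        rw [mul_sum, mul_sum]
        exact sum_le_sum fun t ht => hstep s t (mem_filter.1 ht).2
      have hih := mul_le_mul_of_nonneg_left ih hs2'
      have hch : ((s : ℝ) - 2) * (s + 1).choose 3 = (s + 1) * s.choose 3 := by
        have h1 := choose_three_real s
        have h2 := choose_three_real (s + 1)
        push_cast at h2
        linear_combination ((s : ℝ) - 2) / 6 * h2 - ((s : ℝ) + 1) / 6 * h1
      refine le_of_mul_le_mul_left ?_ hpos
      push_cast at hih
      have hkey : ((s : ℝ) - 2) * (c * ((s + 1 - n / n.choose 3 * (s + 1).choose 3) / 2)) =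
          (s + 1) * (c * ((s - n / n.choose 3 * s.choose 3) / 2)) - (s + 1) * c := by
        linear_combination (-c * (n / n.choose 3) / 2) * hch
      linarith

variable {α : Type*} [Fintype α] [LinearOrder α] {M : Matroid α} {A : SamplingAlgorithm α}

theorem sum_binomial_le_selectionProb {p : unitInterval}
    (hlaw : A.sampleLaw = ProbabilityTheory.binomial (Fintype.card α) p) {e : α} {f : ℕ → ℝ}
    (hf : ∀ s ≤ Fintype.card α,
      f s ≤ ((univ.filter fun σ : Arrival α => e ∈ A.output s σ).card : ℝ)) :
    (∑ k ∈ Iic (Fintype.card α), ((Fintype.card α).choose k * (p : ℝ) ^ k *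
      (1 - p) ^ (Fintype.card α - k)) * f k) / Fintype.card (Arrival α) ≤ selectionProb A e := by
  classical
  rw [selectionProb]
  refine div_le_div_of_nonneg_right ?_ (Nat.cast_nonneg _)
  simp only [hlaw, binomial_real_eq_sum]
  rw [sum_comm]
  refine sum_le_sum fun k hk => ?_
  rw [← mul_sum]
  have hw : (0 : ℝ) ≤ (Fintype.card α).choose k * (p : ℝ) ^ k * (1 - p) ^ (Fintype.card α - k) :=
    mul_nonneg (mul_nonneg (Nat.cast_nonneg _) (pow_nonneg p.2.1 _))
      (pow_nonneg (sub_nonneg.2 p.2.2) _)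
  refine mul_le_mul_of_nonneg_left ((hf k (mem_Iic.1 hk)).trans (le_of_eq ?_)) hw
  rw [card_filter, Nat.cast_sum]
  refine sum_congr rfl fun σ _ => ?_
  by_cases h : e ∈ A.output k σ <;> simp [h]

theorem le_selectionProb_of_hasForbiddenSets (hE : M.E = Set.univ) (hA : HasForbiddenSets M A 3)
    {p : unitInterval} (hlaw : A.sampleLaw = ProbabilityTheory.binomial (Fintype.card α) p) {e : α}
    (he : e ∈ greedyOpt M univ) : ((p : ℝ) - p ^ 3) / 2 ≤ selectionProb A e := by
  obtain ⟨-, -, -, F, hF, hsel⟩ := hA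
  set n := Fintype.card α with hn
  have hn0 : 0 < n := Fintype.card_pos_iff.2 ⟨e⟩
  have hcard : ∀ X Y : Finset α, e ∈ Y → X ⊆ Y.erase e → (F X Y e).card ≤ 3 := fun X Y heY hX =>
    (hF X Y e (mem_greedyOpt_of_subset hE (subset_univ Y) he heY) hX).2
  set N : ℝ := (Fintype.card (Arrival α) : ℝ) with hN
  have hNpos : 0 < N := by
    rw [hN]
    exact_mod_cast Fintype.card_pos_iff.2 ⟨(Fintype.equivFin α).symm⟩
  have hnR : (0 : ℝ) < n := by exact_mod_cast hn0
  let u : ℕ → Fin n → ℝ := fun s t => ((goodOrders F e s t).card : ℝ)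
  have hdiag : ∀ t : Fin n, u t t = N / n := fun t => by
    rw [eq_div_iff hnR.ne', mul_comm]
    simp only [u, hN]
    exact_mod_cast card_goodOrders_self F e t
  -- Good orders all select e, and different t give disjoint sets because e arrives only once.
  have hcount : ∀ s ≤ n, ∑ t ∈ univ.filter (fun t : Fin n => s ≤ (t : ℕ)), u s t ≤
      ((univ.filter fun σ : Arrival α => e ∈ A.output s σ).card : ℝ) := by
    classical
    intro s hs
    simp only [u]
    rw [← Nat.cast_sum, Nat.cast_le, ← card_biUnion]
    · refine card_le_card fun σ hσ => ?_
      obtain ⟨t, ht, hσ⟩ := mem_biUnion.1 hσ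
      rw [mem_goodOrders] at hσ
      obtain ⟨rfl, hσ⟩ := hσ
      exact mem_filter.2 ⟨mem_univ _, hsel s hs σ t (mem_filter.1 ht).2
        (mem_greedyOpt_of_subset hE (subset_univ _) he
          (apply_mem_arrived.2 (Nat.lt_succ_self _))) hσ⟩
    · intro t _ t' _ hne
      refine disjoint_left.2 fun σ h h' => hne (σ.injective ?_)
      rw [(mem_goodOrders.1 h).1, (mem_goodOrders.1 h').1]
  -- Below 3 the coefficient n / n.choose 3 is meaningless. The diagonal term alone is used instead,
  -- with s.choose n as the indicator of s = n among s ≤ n, giving (1 - pⁿ)/n.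
  rcases lt_or_ge n 3 with h3 | h3
  · have hf : ∀ s ≤ n, N / n * (1 - s.choose n) ≤
        ((univ.filter fun σ : Arrival α => e ∈ A.output s σ).card : ℝ) := by
      intro s hs
      refine le_trans ?_ (hcount s hs)
      rcases hs.lt_or_eq with h | rfl
      · rw [Nat.choose_eq_zero_of_lt h, Nat.cast_zero, sub_zero, mul_one, ← hdiag ⟨s, h⟩]
        exact single_le_sum (f := u s) (fun t _ => Nat.cast_nonneg _)
          (mem_filter.2 ⟨mem_univ (⟨s, h⟩ : Fin n), le_rfl⟩)
      · simp only [Nat.choose_self, Nat.cast_one, sub_self, mul_zero]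
        exact sum_nonneg fun t _ => Nat.cast_nonneg _
    have h0 := sum_binomial_mul_choose n 0 p
    have h1 := sum_binomial_mul_choose n n p
    simp only [Nat.choose_zero_right, Nat.cast_one, mul_one, pow_zero, Nat.choose_self,
      one_mul] at h0 h1
    have hsum : ∑ k ∈ Iic n, (n.choose k * (p : ℝ) ^ k * (1 - p) ^ (n - k)) *
        (N / n * (1 - k.choose n)) = N / n * (1 - (p : ℝ) ^ n) := by
      refine Eq.trans ?_ (congrArg₂ (fun x y => N / n * (x - y)) h0 h1)
      rw [← sum_sub_distrib, mul_sum]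
      exact sum_congr rfl fun k _ => by ring
    refine le_trans ?_ ((div_le_div_of_nonneg_right hsum.ge hNpos.le).trans
      (sum_binomial_le_selectionProb hlaw hf))
    have hp0 := p.2.1
    have hp1 := p.2.2
    have hmul := mul_nonneg hp0 (sub_nonneg.2 hp1)
    have hmul' := mul_nonneg hp0 hmul
    have hN' : N / n * (1 - (p : ℝ) ^ n) / N = (1 - (p : ℝ) ^ n) / n := by field_simp
    rw [hN']
    obtain h | h : n = 1 ∨ n = 2 := by omega
    · rw [h]
      norm_num
      nlinarith
    · rw [h]
      norm_num
      nlinarith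
  · have hstep : ∀ (s : ℕ) (t : Fin n), s < t →
        ((s : ℝ) - 2) * u (s + 1) t ≤ (s + 1) * u s t := by
      intro s t hst
      have h : ((s : ℝ) + 1) * u (s + 1) t ≤ (s + 1) * u s t + 3 * u (s + 1) t := by
        simp only [u]
        exact_mod_cast card_goodOrders_succ hcard hst
      linarith
    have hC : (0 : ℝ) < n.choose 3 := by exact_mod_cast Nat.choose_pos h3
    have h1 := sum_binomial_mul_choose n 1 p
    have h2 := sum_binomial_mul_choose n 3 p
    simp only [Nat.choose_one_right, pow_one] at h1
    have hsum : ∑ k ∈ Iic n, (n.choose k * (p : ℝ) ^ k * (1 - p) ^ (n - k)) *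
        (N / n * ((k - n / n.choose 3 * k.choose 3) / 2)) =
        N / n / 2 * (n * p - n / n.choose 3 * (n.choose 3 * (p : ℝ) ^ 3)) := by
      rw [← h1, ← h2, mul_sum, ← sum_sub_distrib, mul_sum]
      exact sum_congr rfl fun k _ => by ring
    refine le_trans (le_of_eq ?_) ((div_le_div_of_nonneg_right hsum.ge hNpos.le).trans
      (sum_binomial_le_selectionProb hlaw fun s hs =>
        (le_sum_of_recurrence h3 (div_nonneg hNpos.le hnR.le) u (fun _ _ => Nat.cast_nonneg _)
          hdiag hstep hs).trans (hcount s hs)))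
    field_simp

end Competitive

end SecretaryMSP

theorem mainTheorem10 {α : Type*} [Fintype α] [LinearOrder α]
    (S : SecretaryMSP.LaminarSystem α) :
    Nonempty S.Drawing ∧
    ∀ D : S.Drawing,
      (∀ p : unitInterval,
        SecretaryMSP.HasForbiddenSets S.matroid (SecretaryMSP.laminarAlgorithm D p) 3) ∧
      SecretaryMSP.IsProbCompetitive S.matroid
        (SecretaryMSP.laminarAlgorithm D
          ⟨√(1 / 3), Real.sqrt_nonneg _, Real.sqrt_le_one.2 (by norm_num)⟩)
        (3 * √3) := by
  refine ⟨S.nonempty_drawing, fun D =>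
    ⟨SecretaryMSP.hasForbiddenSets_laminarAlgorithm D, ?_, fun e he => ?_⟩⟩
  · have : 1 ≤ √3 := Real.one_le_sqrt.2 (by norm_num)
    linarith
  -- At p = 1/√3, the maximiser of (p - p³)/2 on [0, 1], the bound equals 1/(3√3).
  · refine le_trans (le_of_eq ?_) (SecretaryMSP.le_selectionProb_of_hasForbiddenSets
      S.matroid_ground (SecretaryMSP.hasForbiddenSets_laminarAlgorithm D _) rfl he)
    have h3 : √3 ^ 2 = 3 := Real.sq_sqrt (by norm_num)
    have hpos : 0 < √3 := Real.sqrt_pos.2 (by norm_num)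
    have hp : √(1 / 3) = 1 / √3 := by rw [Real.sqrt_div zero_le_one, Real.sqrt_one]
    simp only [hp]
    field_simp
    rw [h3]
    norm_num
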